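/- Let $n\ge 1$ and $C\ge 1$, and let $A_{-1},A_0,A_1,B_0,C_0$ be real $n\times n$ matrices such that $A_{-1},A_1\ge 0$, the off-diagonal entries of $A_0,B_0,C_0$ are nonnegative, and $(A_{-1}+A_0+A_1)\mathbf 1=(B_0+A_1)\mathbf 1=(A_{-1}+C_0)\mathbf 1=\mathbf 0$. The finite quasi-birth-and-death (QBD) process is the continuous-time Markov chain on $\{0,\dots,C\}\times\{1,\dots,n\}$ whose generator $Q$ is block tridiagonal, with upper-diagonal blocks $A_1$, lower-diagonal blocks $A_{-1}$ and diagonal blocks $B_0,A_0,\dots,A_0,C_0$. The corresponding unrestricted QBD process is the chain on $\{0,1,2,\dots\}\times\{1,\dots,n\}$ with upper-diagonal blocks $A_1$, lower-diagonal blocks $A_{-1}$ and diagonal blocks $B_0,A_0,A_0,\dots$. Assume that the finite QBD process, the unrestricted QBD process and the phase process with generator $A_{-1}+A_0+A_1$ are irreducible, and that the unrestricted QBD process is not null recurrent. Then the matrix equations $A_{-1}+A_0X+A_1X^2=0$ and $A_1+A_0X+A_{-1}X^2=0$ have (entrywise) minimal nonnegative solutions, denoted by $G$ and $\hat G$ respectively;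 the matrices $-(A_0+A_1G)$ and $-(A_0+A_{-1}\hat G)$ are invertible; and, with $$R=A_1\bigl(-(A_0+A_1G)\bigr)^{-1},\qquad \hat R=A_{-1}\bigl(-(A_0+A_{-1}\hat G)\bigr)^{-1},$$ the unique stationary distribution $\pi=(\pi_0,\dots,\pi_C)$ of the finite QBD process (that is, $\pi\ge 0$, $\pi Q=\mathbf 0$, $\pi\mathbf 1=1$, with blocks $\pi_k$ of length $n$) is given by $$\pi_k=v_0R^k+v_C\hat R^{\,C-k},\qquad 0\le k\le C,$$ where $(v_0,v_C)\in\mathbb R^n\times\mathbb R^n$ (row vectors) is the unique solution of the system $$(v_0,v_C)\begin{bmatrix}B_0+RA_{-1}&R^{C-1}(RC_0+A_1)\\ \hat R^{C-1}(\hat RB_0+A_{-1})&C_0+\hat RA_1\end{bmatrix}=\mathbf 0,\qquad v_0\sum_{i=0}^{C}R^i\mathbf 1+v_C\sum_{i=0}^{C}\hat R^i\mathbf 1=1.$$ -/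

import Mathlib

open scoped ENNReal Matrix

/-- The five `n × n` blocks of a level-independent quasi-birth-and-death process: `Am` (one level
down), `A0` (same level) and `Ap` (one level up), with `B0` in place of `A0` at the lower boundary
level and `C0` in place of `A0` at the upper boundary level.  Transition rates are nonnegative
and the rows of the resulting generators sum to zero. -/
structure IsQBD {n : ℕ} (Am A0 Ap B0 C0 : Matrix (Fin n) (Fin n) ℝ) : Prop where
  down_nonneg : ∀ i j, 0 ≤ Am i j
  up_nonneg : ∀ i j, 0 ≤ Ap i j
  mid_nonneg : ∀ i j, i ≠ j → 0 ≤ A0 i j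
  lower_nonneg : ∀ i j, i ≠ j → 0 ≤ B0 i j
  upper_nonneg : ∀ i j, i ≠ j → 0 ≤ C0 i j
  mid_sum : ∀ i, ∑ j, (Am i j + A0 i j + Ap i j) = 0
  lower_sum : ∀ i, ∑ j, (B0 i j + Ap i j) = 0
  upper_sum : ∀ i, ∑ j, (Am i j + C0 i j) = 0

/-- The block-tridiagonal generator of the finite QBD process with levels `0, …, C` (`1 ≤ C`). -/
def finiteQBD {n : ℕ} (C : ℕ) (Am A0 Ap B0 C0 : Matrix (Fin n) (Fin n) ℝ) :
    Matrix (Fin (C + 1) × Fin n) (Fin (C + 1) × Fin n) ℝ := fun x y =>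
  if y.1.val = x.1.val + 1 then Ap x.2 y.2
  else if x.1.val = y.1.val + 1 then Am x.2 y.2
  else if x.1.val = y.1.val then
    (if x.1.val = 0 then B0 x.2 y.2 else if x.1.val = C then C0 x.2 y.2 else A0 x.2 y.2)
  else 0

/-- The generator of the unrestricted QBD process: levels `0, 1, 2, …` without upper boundary. -/
def unrestrictedQBD {n : ℕ} (Am A0 Ap B0 : Matrix (Fin n) (Fin n) ℝ) :
    (ℕ × Fin n) → (ℕ × Fin n) → ℝ := fun x y =>
  if y.1 = x.1 + 1 then Ap x.2 y.2
  else if x.1 = y.1 + 1 then Am x.2 y.2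
  else if x.1 = y.1 then (if x.1 = 0 then B0 x.2 y.2 else A0 x.2 y.2)
  else 0

/-- Irreducibility of transition rates `q`: every state can be reached from every state. -/
def IrreducibleRates {S : Type*} (q : S → S → ℝ) : Prop :=
  ∀ x y, Relation.ReflTransGen (fun a b => 0 < q a b) x y

/-- Transition probabilities of the embedded jump chain of a continuous-time Markov chain with
generator `q` (having no absorbing state). -/
noncomputable def jumpProb {S : Type*} [DecidableEq S] (q : S → S → ℝ) (x y : S) : ℝ≥0∞ :=
  if x = y then 0 else ENNReal.ofReal (q x y / (-q x x))

/-- `tabooProb q x m y` is the probability that the jump chain started in `x` is in `y` after `m`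
jumps, without having returned to `x` during the jumps `1, …, m`. -/
noncomputable def tabooProb {S : Type*} [DecidableEq S] (q : S → S → ℝ) (x : S) :
    ℕ → S → ℝ≥0∞
  | 0, y => if y = x then 1 else 0
  | m + 1, y => if y = x then 0 else ∑' z, tabooProb q x m z * jumpProb q z y

/-- The probability that the chain started in `x` returns to `x` after leaving it: the sum over
`m` of the probability that the first return occurs at the jump `m + 1`. -/
noncomputable def returnProb {S : Type*} [DecidableEq S] (q : S → S → ℝ) (x : S) : ℝ≥0∞ :=
  ∑' m, ∑' z, tabooProb q x m z * jumpProb q z x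

/-- The expected (continuous) time until the first return to `x` after leaving it: each visit to
a state `z` before the return contributes the mean holding time `1 / (-q z z)`. It is the mean
return time when the return probability is one. -/
noncomputable def meanReturnTime {S : Type*} [DecidableEq S] (q : S → S → ℝ) (x : S) : ℝ≥0∞ :=
  ∑' m, ∑' z, tabooProb q x m z * ENNReal.ofReal (1 / (-q z z))

/-- The chain is null recurrent: every state is recurrent, with infinite mean return time. -/
def IsNullRecurrent {S : Type*} [DecidableEq S] (q : S → S → ℝ) : Prop :=
  ∀ x, returnProb q x = 1 ∧ meanReturnTime q x = ⊤

/-- `X` is the minimal (entrywise) nonnegative solution of `P + L X + U X² = 0`. -/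
def IsMinNonnegSol {n : ℕ} (P L U X : Matrix (Fin n) (Fin n) ℝ) : Prop :=
  (∀ i j, 0 ≤ X i j) ∧ P + L * X + U * X ^ 2 = 0 ∧
    ∀ Y : Matrix (Fin n) (Fin n) ℝ, (∀ i j, 0 ≤ Y i j) → P + L * Y + U * Y ^ 2 = 0 →
      ∀ i j, X i j ≤ Y i j

/-- `p` is a stationary distribution of the finite continuous-time chain with generator `Q`. -/
def IsStationaryDist {S : Type*} [Fintype S] (Q : Matrix S S ℝ) (p : S → ℝ) : Prop :=
  (∀ x, 0 ≤ p x) ∧ ∑ x, p x = 1 ∧ p ᵥ* Q = 0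

/-- The `2n × 2n` matrix of the boundary system. -/
def boundaryMatrix {n : ℕ} (C : ℕ) (Am Ap B0 C0 R Rh : Matrix (Fin n) (Fin n) ℝ) :
    Matrix (Fin n ⊕ Fin n) (Fin n ⊕ Fin n) ℝ :=
  Matrix.fromBlocks
    (B0 + R * Am) (R ^ (C - 1) * (R * C0 + Ap))
    (Rh ^ (C - 1) * (Rh * B0 + Am)) (C0 + Rh * Ap)

/-- The pair of row vectors `v = (v₀, v_C)` solves the boundary system and is normalised. -/
def SolvesBoundary {n : ℕ} (C : ℕ) (Am Ap B0 C0 R Rh : Matrix (Fin n) (Fin n) ℝ)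
    (v : (Fin n → ℝ) × (Fin n → ℝ)) : Prop :=
  Sum.elim v.1 v.2 ᵥ* boundaryMatrix C Am Ap B0 C0 R Rh = 0 ∧
    v.1 ⬝ᵥ ((∑ i ∈ Finset.range (C + 1), R ^ i) *ᵥ (fun _ => 1)) +
      v.2 ⬝ᵥ ((∑ i ∈ Finset.range (C + 1), Rh ^ i) *ᵥ (fun _ => 1)) = 1

/-! The matrices `R` and `Rh` solve the two dual quadratic equations, so the blocks `v₀ R^k + v_C
Rh^(C-k)` satisfy the balance equations at interior levels; those at levels `0` and `C` are exactly
the boundary system. Null vectors of the boundary matrix thus give invariant vectors of `Q`, which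
irreducibility determines by their total mass. The boundary matrix is singular because its rows sum
to zero (`boundaryMatrix_mulVec_one`). Existence and uniqueness of the normalised solution therefore
reduce to injectivity of `v ↦ geometricVector`, which follows from invertibility of `1 - R * Rh`
(`geometricVector_injective`).

That matrix equals `-W * (-(A0 + Am * Gh))⁻¹` with `W = A0 + Am * Gh + Ap * G`, so `W` has to be
invertible, and here the exclusion of null recurrence enters. Solve the Poisson equation for the
level drift `d` (`exists_drift`). If `d = 0`, level plus a phase weight is harmonic above level `0`;
this forces recurrence and rules out a finite mean return time (`isNullRecurrent_of_drift_eq_zero`).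
If `d ≠ 0`, a perturbation of the constant function gives `x, y > 0` with `(Am + x A0 + x² Ap) y <
0`. Monotone iteration then yields `G` with `G y ≤ x y` and `Gh` with `Gh y ≤ x⁻¹ y`. Hence `W y <
0`, and diagonal dominance makes `W` invertible. -/

/-! ### Finite irreducible generators and their invariant vectors -/

/-- A function which is subharmonic for a finite irreducible generator is constant. -/
theorem eq_of_mulVec_nonneg {S : Type*} [Fintype S] {Q : Matrix S S ℝ}
    (hoff : ∀ x y, x ≠ y → 0 ≤ Q x y) (hsum : ∀ x, ∑ y, Q x y = 0) (hirr : IrreducibleRates Q)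
    {v : S → ℝ} (hv : ∀ x, 0 ≤ (Q *ᵥ v) x) (x y : S) : v x = v y := by
  classical
  have : Nonempty S := ⟨x⟩
  obtain ⟨m, hm⟩ := Finite.exists_max v
  have key : ∀ z, v z = v m := by
    intro z
    -- Maximum principle: at a maximiser `a`, `(Q v) a = ∑ Q a z (v z - v m)` has only nonpositive
    -- terms, so maximality passes along every positive rate.
    refine Relation.ReflTransGen.head_induction_on (motive := fun a _ => v a = v m → v z = v m)
      (hirr m z) (fun h => h) ?_ rfl
    intro a b hab _ ih ha
    apply ih
    by_contra hne
    have hlt : v b < v m := lt_of_le_of_ne (hm b) hne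
    have h1 : (Q *ᵥ v) a = ∑ z, Q a z * (v z - v m) := by
      simp only [mul_sub, Finset.sum_sub_distrib, ← Finset.sum_mul, hsum, Matrix.mulVec, dotProduct]
      ring
    have h2 : ∑ z, Q a z * (v z - v m) < ∑ z : S, (0 : ℝ) := by
      apply Finset.sum_lt_sum
      · intro z _
        by_cases haz : a = z
        · subst haz; simp [ha]
        · exact mul_nonpos_of_nonneg_of_nonpos (hoff a z haz) (sub_nonpos.2 (hm z))
      · exact ⟨b, Finset.mem_univ _, mul_neg_of_pos_of_neg hab (sub_neg.2 hlt)⟩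
    have := hv a
    simp only [Finset.sum_const_zero] at h2
    linarith
  rw [key x, key y]

/-- Adding the all-ones matrix to a finite irreducible generator makes it invertible. -/
theorem isUnit_add_ones {S : Type*} [Fintype S] [DecidableEq S] {Q : Matrix S S ℝ}
    (hoff : ∀ x y, x ≠ y → 0 ≤ Q x y) (hsum : ∀ x, ∑ y, Q x y = 0) (hirr : IrreducibleRates Q) :
    IsUnit (Q + Matrix.of fun _ _ => (1 : ℝ)) := by
  rw [← Matrix.mulVec_injective_iff_isUnit]
  refine (injective_iff_map_eq_zero (Matrix.mulVecLin (Q + Matrix.of fun _ _ => (1 : ℝ)))).2 ?_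
  intro v hv
  -- On the kernel `Q v` is constant, so `v` or `-v` is subharmonic and `v` is constant; then `Q v =
  -- 0`, and the sum of `v` vanishes too.
  have hQ : ∀ x, (Q *ᵥ v) x = - ∑ y, v y := by
    intro x
    have h := congrFun hv x
    simp only [Matrix.mulVecLin_apply, Matrix.add_mulVec, Pi.add_apply, Pi.zero_apply] at h
    have h1 : ((Matrix.of fun _ _ => (1 : ℝ)) *ᵥ v : S → ℝ) x = ∑ y, v y := by
      simp [Matrix.mulVec, dotProduct]
    linarith
  have hc : ∀ x y, v x = v y := by
    rcases le_total 0 (∑ y, v y) with h | h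
    · intro x y
      have := eq_of_mulVec_nonneg (v := -v) hoff hsum hirr
        (fun x => by rw [Matrix.mulVec_neg, Pi.neg_apply, hQ]; linarith) x y
      simpa using this
    · exact eq_of_mulVec_nonneg hoff hsum hirr (fun x => by rw [hQ]; linarith)
  ext x
  have h0 : (Q *ᵥ v) x = 0 := by
    have : (Q *ᵥ v) x = ∑ y, Q x y * v x := Finset.sum_congr rfl fun y _ => by rw [hc y x]
    rw [this, ← Finset.sum_mul, hsum, zero_mul]
  have h1 : ∑ y, v y = (Fintype.card S : ℝ) * v x := by
    rw [Finset.sum_congr rfl (fun y _ => hc y x)]; simp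
  rw [hQ, h1] at h0
  have : Nonempty S := ⟨x⟩
  have : (Fintype.card S : ℝ) ≠ 0 := by exact_mod_cast Fintype.card_ne_zero
  simpa [this] using h0

/-- Invariant vectors of a finite irreducible generator are determined by their total mass. -/
theorem eq_of_vecMul_eq_zero {S : Type*} [Fintype S] {Q : Matrix S S ℝ}
    (hoff : ∀ x y, x ≠ y → 0 ≤ Q x y) (hsum : ∀ x, ∑ y, Q x y = 0) (hirr : IrreducibleRates Q)
    {u v : S → ℝ} (hu : u ᵥ* Q = 0) (hv : v ᵥ* Q = 0) (huv : ∑ x, u x = ∑ x, v x) : u = v := by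
  classical
  have hU := Matrix.vecMul_injective_of_isUnit (isUnit_add_ones hoff hsum hirr)
  apply hU
  ext x
  simp only [Matrix.vecMul_add, hu, hv, Pi.add_apply]
  simp [Matrix.vecMul, dotProduct, huv]

/-- A finite irreducible generator has an invariant vector of total mass one. -/
theorem exists_vecMul_eq_zero {S : Type*} [Fintype S] [Nonempty S] {Q : Matrix S S ℝ}
    (hoff : ∀ x y, x ≠ y → 0 ≤ Q x y) (hsum : ∀ x, ∑ y, Q x y = 0) (hirr : IrreducibleRates Q) :
    ∃ u : S → ℝ, u ᵥ* Q = 0 ∧ ∑ x, u x = 1 := by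
  classical
  -- Summing the entries of `u (Q + J) = 1`, with `J` all ones, removes `u Q` because the rows of
  -- `Q` sum to zero; this gives mass one, and then `u Q = 0`.
  obtain ⟨u, hu⟩ := (Matrix.vecMul_surjective_iff_isUnit.2 (isUnit_add_ones hoff hsum hirr))
    (fun _ => (1 : ℝ))
  have h1 : ∀ y, (u ᵥ* Q) y + ∑ x, u x = 1 := by
    intro y
    have := congrFun hu y
    simp only [Matrix.vecMul_add, Pi.add_apply] at this
    rw [← this]
    congr 1
    simp [Matrix.vecMul, dotProduct]
  have h2 : ∑ y, (u ᵥ* Q) y = 0 := by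
    simp only [Matrix.vecMul, dotProduct]
    rw [Finset.sum_comm]
    simp [← Finset.mul_sum, hsum]
  have hcard : (Fintype.card S : ℝ) ≠ 0 := by exact_mod_cast Fintype.card_ne_zero
  have h3 : ∑ x, u x = 1 := by
    have h4 : ∑ y : S, ((u ᵥ* Q) y + ∑ x, u x) = ∑ y : S, (1 : ℝ) :=
      Finset.sum_congr rfl fun y _ => h1 y
    rw [Finset.sum_add_distrib, h2] at h4
    simpa [hcard] using h4
  refine ⟨u, ?_, h3⟩
  ext y
  have := h1 y
  simp only [Pi.zero_apply]
  linarith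

/-- A finite irreducible chain has exactly one stationary distribution. -/
theorem existsUnique_isStationaryDist {S : Type*} [Fintype S] [Nonempty S] {Q : Matrix S S ℝ}
    (hoff : ∀ x y, x ≠ y → 0 ≤ Q x y) (hsum : ∀ x, ∑ y, Q x y = 0) (hirr : IrreducibleRates Q) :
    ∃! p, IsStationaryDist Q p := by
  classical
  obtain ⟨u, hu, hu1⟩ := exists_vecMul_eq_zero hoff hsum hirr
  -- The triangle inequality gives `|u| Q ≥ 0`, while its entries sum to zero. So `|u|` is itself
  -- invariant, which provides a nonnegative solution.
  have habs : ∀ y, 0 ≤ ((fun x => |u x|) ᵥ* Q) y := by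
    intro y
    have h0 : u y * Q y y + ∑ x ∈ Finset.univ.erase y, u x * Q x y = 0 := by
      rw [Finset.add_sum_erase _ (fun x => u x * Q x y) (Finset.mem_univ y)]
      exact congrFun hu y
    have hd : Q y y ≤ 0 := by
      have h := hsum y
      rw [← Finset.add_sum_erase _ _ (Finset.mem_univ y)] at h
      have := Finset.sum_nonneg (s := Finset.univ.erase y) (f := fun z => Q y z)
        (fun z hz => hoff y z (Finset.ne_of_mem_erase hz).symm)
      linarith
    have h1 : ((fun x => |u x|) ᵥ* Q) y =
        |u y| * Q y y + ∑ x ∈ Finset.univ.erase y, |u x| * Q x y :=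
      (Finset.add_sum_erase _ (fun x => |u x| * Q x y) (Finset.mem_univ y)).symm
    have h2 : |∑ x ∈ Finset.univ.erase y, u x * Q x y| ≤
        ∑ x ∈ Finset.univ.erase y, |u x| * Q x y := by
      refine (Finset.abs_sum_le_sum_abs _ _).trans (Finset.sum_le_sum fun x hx => ?_)
      rw [abs_mul, abs_of_nonneg (hoff x y (Finset.ne_of_mem_erase hx))]
    have h3 : ∑ x ∈ Finset.univ.erase y, u x * Q x y = -(u y * Q y y) := by linarith
    rw [h3, abs_neg, abs_mul, abs_of_nonpos hd] at h2
    linarith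
  have habs0 : (fun x => |u x|) ᵥ* Q = 0 := by
    have h2 : ∑ y, ((fun x => |u x|) ᵥ* Q) y = 0 := by
      simp only [Matrix.vecMul, dotProduct]
      rw [Finset.sum_comm]
      simp [← Finset.mul_sum, hsum]
    ext y
    exact (Finset.sum_eq_zero_iff_of_nonneg (fun y _ => habs y)).1 h2 y (Finset.mem_univ y)
  have hs : 1 ≤ ∑ x, |u x| := hu1 ▸ (Finset.sum_le_sum fun x _ => le_abs_self (u x))
  have hpos : 0 < ∑ x, |u x| := by linarith
  refine ⟨(∑ x, |u x|)⁻¹ • fun x => |u x|, ⟨fun x => ?_, ?_, ?_⟩, ?_⟩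
  · simp only [Pi.smul_apply, smul_eq_mul]; positivity
  · simp only [Pi.smul_apply, smul_eq_mul, ← Finset.mul_sum]
    exact inv_mul_cancel₀ hpos.ne'
  · rw [Matrix.smul_vecMul, habs0, smul_zero]
  · rintro p ⟨_, hp1, hp⟩
    apply eq_of_vecMul_eq_zero hoff hsum hirr hp
    · rw [Matrix.smul_vecMul, habs0, smul_zero]
    · simp only [Pi.smul_apply, smul_eq_mul, ← Finset.mul_sum]
      rw [hp1, inv_mul_cancel₀ hpos.ne']

/-! ### Diagonal dominance and minimal solutions of matrix quadratics -/

/-- A matrix with nonnegative off-diagonal entries that maps a positive vector to a negative one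
is invertible. -/
theorem isUnit_of_mulVec_neg {S : Type*} [Fintype S] [DecidableEq S] {W : Matrix S S ℝ}
    (hoff : ∀ i j, i ≠ j → 0 ≤ W i j) {y : S → ℝ} (hy : ∀ i, 0 < y i)
    (hW : ∀ i, (W *ᵥ y) i < 0) : IsUnit W := by
  -- Scaling the columns by `y` makes the matrix strictly diagonally dominant.
  have hdet : (W * Matrix.diagonal y).det ≠ 0 := by
    apply det_ne_zero_of_sum_row_lt_diag
    intro k
    have h := hW k
    simp only [Matrix.mulVec, dotProduct] at h
    rw [← Finset.add_sum_erase _ _ (Finset.mem_univ k)] at h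
    have h1 : ∑ j ∈ Finset.univ.erase k, ‖(W * Matrix.diagonal y) k j‖ =
        ∑ j ∈ Finset.univ.erase k, W k j * y j := by
      refine Finset.sum_congr rfl fun j hj => ?_
      rw [Matrix.mul_diagonal, Real.norm_of_nonneg]
      exact mul_nonneg (hoff k j (Finset.ne_of_mem_erase hj).symm) (hy j).le
    have h2 := neg_le_abs (W k k * y k)
    rw [h1, Matrix.mul_diagonal, Real.norm_eq_abs]
    linarith
  rw [Matrix.isUnit_iff_isUnit_det, isUnit_iff_ne_zero]
  rw [Matrix.det_mul] at hdet
  exact left_ne_zero_of_mul hdet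

theorem mul_entries_nonneg {n : ℕ} {A B : Matrix (Fin n) (Fin n) ℝ}
    (hA : ∀ i j, 0 ≤ A i j) (hB : ∀ i j, 0 ≤ B i j) (i j) : 0 ≤ (A * B) i j := by
  rw [Matrix.mul_apply]
  exact Finset.sum_nonneg fun k _ => mul_nonneg (hA i k) (hB k j)

theorem mul_entries_mono {n : ℕ} {A A' B B' : Matrix (Fin n) (Fin n) ℝ}
    (hA : ∀ i j, 0 ≤ A i j) (hB : ∀ i j, 0 ≤ B i j) (hAA : ∀ i j, A i j ≤ A' i j)
    (hBB : ∀ i j, B i j ≤ B' i j) (i j) : (A * B) i j ≤ (A' * B') i j := by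
  rw [Matrix.mul_apply, Matrix.mul_apply]
  exact Finset.sum_le_sum fun k _ =>
    mul_le_mul (hAA i k) (hBB k j) (hB k j) ((hA i k).trans (hAA i k))

theorem mulVec_apply_eq_sum {n : ℕ} (A : Matrix (Fin n) (Fin n) ℝ) (v : Fin n → ℝ) (i) :
    (A *ᵥ v) i = ∑ j, A i j * v j := rfl

theorem mulVec_entries_mono {n : ℕ} {A : Matrix (Fin n) (Fin n) ℝ}
    (hA : ∀ i j, 0 ≤ A i j) {u v : Fin n → ℝ} (h : ∀ i, u i ≤ v i) (i) :
    (A *ᵥ u) i ≤ (A *ᵥ v) i := by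
  rw [mulVec_apply_eq_sum, mulVec_apply_eq_sum]
  exact Finset.sum_le_sum fun k _ => mul_le_mul_of_nonneg_left (h k) (hA i k)

/-- If `(P + x L + x² U) y < 0` for some `x, y > 0`, then `P + L X + U X² = 0` has a minimal
nonnegative solution `X`, and `X y ≤ x y`. -/
theorem exists_isMinNonnegSol {n : ℕ} {P L U : Matrix (Fin n) (Fin n) ℝ}
    (hP : ∀ i j, 0 ≤ P i j) (hL : ∀ i j, i ≠ j → 0 ≤ L i j) (hU : ∀ i j, 0 ≤ U i j)
    {x : ℝ} (hx : 0 < x) {y : Fin n → ℝ} (hy : ∀ i, 0 < y i)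
    (hneg : ∀ i, (P *ᵥ y) i + x * (L *ᵥ y) i + x ^ 2 * (U *ᵥ y) i < 0) :
    ∃ X, IsMinNonnegSol P L U X ∧ ∀ i, (X *ᵥ y) i ≤ x * y i := by
  have hd : ∀ i, L i i < 0 := by
    intro i
    by_contra! h
    have hL' : ∀ j, 0 ≤ L i j := fun j => by
      by_cases hij : i = j
      · exact hij ▸ h
      · exact hL i j hij
    have h1 : 0 ≤ (P *ᵥ y) i :=
      (Finset.sum_nonneg fun k _ => mul_nonneg (hP i k) (hy k).le).trans_eq
        (mulVec_apply_eq_sum P y i).symm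
    have h2 : 0 ≤ (L *ᵥ y) i :=
      (Finset.sum_nonneg fun k _ => mul_nonneg (hL' k) (hy k).le).trans_eq
        (mulVec_apply_eq_sum L y i).symm
    have h3 : 0 ≤ (U *ᵥ y) i :=
      (Finset.sum_nonneg fun k _ => mul_nonneg (hU i k) (hy k).le).trans_eq
        (mulVec_apply_eq_sum U y i).symm
    have := hneg i
    have h4 : 0 ≤ x * (L *ᵥ y) i := mul_nonneg hx.le h2
    have h5 : 0 ≤ x ^ 2 * (U *ᵥ y) i := by positivity
    linarith
  set N : Matrix (Fin n) (Fin n) ℝ := L - Matrix.diagonal (fun i => L i i) with hN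
  have hN0 : ∀ i j, 0 ≤ N i j := by
    intro i j
    by_cases hij : i = j
    · subst hij; simp [hN]
    · simpa [hN, hij] using hL i j hij
  -- Jacobi splitting: the fixed points of `T` are the solutions, and `T` is monotone on nonnegative
  -- matrices since `N ≥ 0` and the diagonal of `L` is negative. The iterates from `0` increase and
  -- stay below every nonnegative solution.
  let T : Matrix (Fin n) (Fin n) ℝ → Matrix (Fin n) (Fin n) ℝ := fun X =>
    Matrix.of fun i j => (P + N * X + U * (X * X)) i j / (-L i i)
  have hTfix : ∀ X, T X = X ↔ P + L * X + U * X ^ 2 = 0 := by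
    intro X
    rw [← Matrix.ext_iff, ← Matrix.ext_iff]
    refine forall_congr' fun i => forall_congr' fun j => ?_
    have h1 : (N * X) i j = (L * X) i j - L i i * X i j := by
      rw [hN, sub_mul, Matrix.sub_apply, Matrix.diagonal_mul]
    simp only [T, Matrix.of_apply, Matrix.add_apply, h1, pow_two, Matrix.zero_apply]
    rw [div_eq_iff (by linarith [hd i])]
    constructor <;> intro h <;> linarith
  have hTnn : ∀ X, (∀ i j, 0 ≤ X i j) → ∀ i j, 0 ≤ T X i j := by
    intro X hX i j
    have h1 := mul_entries_nonneg hN0 hX i j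
    have h2 := mul_entries_nonneg hU (mul_entries_nonneg hX hX) i j
    exact div_nonneg (add_nonneg (add_nonneg (hP i j) h1) h2) (by linarith [hd i])
  have hTmono : ∀ X Y, (∀ i j, 0 ≤ X i j) → (∀ i j, X i j ≤ Y i j) →
      ∀ i j, T X i j ≤ T Y i j := by
    intro X Y hX hXY i j
    have h1 := mul_entries_mono hN0 hX (fun _ _ => le_rfl) hXY i j
    have h2 := mul_entries_mono hU (mul_entries_nonneg hX hX) (fun _ _ => le_rfl)
      (mul_entries_mono hX hX hXY hXY) i j
    exact div_le_div_of_nonneg_right (add_le_add (add_le_add le_rfl h1) h2) (by linarith [hd i])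
  -- The bound is preserved because `X² y ≤ x X y ≤ x² y`, combined with `hneg`. It keeps the
  -- iterates bounded entrywise since `y > 0`.
  have hTy : ∀ X, (∀ i j, 0 ≤ X i j) → (∀ i, (X *ᵥ y) i ≤ x * y i) →
      ∀ i, (T X *ᵥ y) i ≤ x * y i := by
    intro X hX hXy i
    have hdi : 0 < -L i i := by linarith [hd i]
    have h0 : (T X *ᵥ y) i = ((P + N * X + U * (X * X)) *ᵥ y) i / (-L i i) := by
      simp only [Matrix.mulVec, dotProduct, T, Matrix.of_apply, Finset.sum_div]
      exact Finset.sum_congr rfl fun j _ => by ring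
    have h1 : (N *ᵥ (X *ᵥ y)) i ≤ (N *ᵥ (x • y)) i := mulVec_entries_mono hN0 hXy i
    have h2 : (U *ᵥ (X *ᵥ (X *ᵥ y))) i ≤ (U *ᵥ (x • x • y)) i := by
      refine mulVec_entries_mono hU (fun k => ?_) i
      refine (mulVec_entries_mono hX hXy k).trans ?_
      have h3 : X *ᵥ (fun i => x * y i) = x • (X *ᵥ y) := Matrix.mulVec_smul X x y
      rw [h3]
      exact mul_le_mul_of_nonneg_left (hXy k) hx.le
    have h4 : (N *ᵥ (x • y)) i = x * (L *ᵥ y) i - x * (L i i * y i) := by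
      rw [Matrix.mulVec_smul, hN, Matrix.sub_mulVec, Pi.smul_apply, Pi.sub_apply,
        Matrix.mulVec_diagonal, smul_eq_mul]
      ring
    have h5 : (U *ᵥ (x • x • y)) i = x ^ 2 * (U *ᵥ y) i := by
      rw [Matrix.mulVec_smul, Matrix.mulVec_smul, Pi.smul_apply, Pi.smul_apply, smul_eq_mul,
        smul_eq_mul]
      ring
    rw [h0, div_le_iff₀ hdi]
    simp only [Matrix.add_mulVec, Pi.add_apply, ← Matrix.mulVec_mulVec]
    rw [h4] at h1
    rw [h5] at h2
    linarith [hneg i]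
  let Z : ℕ → Matrix (Fin n) (Fin n) ℝ := fun k => T^[k] 0
  have hZs : ∀ k, Z (k + 1) = T (Z k) := fun k => Function.iterate_succ_apply' T k 0
  have hZnn : ∀ k i j, 0 ≤ Z k i j := by
    intro k
    induction k with
    | zero => intro i j; exact le_rfl
    | succ k ih => rw [hZs]; exact hTnn _ ih
  have hZmono : ∀ k i j, Z k i j ≤ Z (k + 1) i j := by
    intro k
    induction k with
    | zero => exact hZnn 1
    | succ k ih => rw [hZs k, hZs (k + 1)]; exact hTmono _ _ (hZnn k) ih
  have hZy : ∀ k i, (Z k *ᵥ y) i ≤ x * y i := by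
    intro k
    induction k with
    | zero =>
      intro i
      have : (Z 0 *ᵥ y) i = 0 := by simp [Z]
      rw [this]; exact (mul_pos hx (hy i)).le
    | succ k ih => rw [hZs]; exact hTy _ (hZnn k) ih
  have hZb : ∀ k i j, Z k i j ≤ x * y i / y j := by
    intro k i j
    rw [le_div_iff₀ (hy j)]
    refine le_trans ?_ (hZy k i)
    exact Finset.single_le_sum (f := fun j => Z k i j * y j)
      (fun l _ => mul_nonneg (hZnn k i l) (hy l).le) (Finset.mem_univ j)
  let X : Matrix (Fin n) (Fin n) ℝ := Matrix.of fun i j => ⨆ k, Z k i j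
  have hlim : Filter.Tendsto Z Filter.atTop (nhds X) := by
    refine tendsto_pi_nhds.2 fun i => tendsto_pi_nhds.2 fun j => ?_
    refine tendsto_atTop_ciSup (monotone_nat_of_le_succ fun k => hZmono k i j) ?_
    exact ⟨x * y i / y j, by rintro _ ⟨k, rfl⟩; exact hZb k i j⟩
  have hlime : ∀ i j, Filter.Tendsto (fun k => Z k i j) Filter.atTop (nhds (X i j)) := fun i j =>
    tendsto_pi_nhds.1 (tendsto_pi_nhds.1 hlim i) j
  have hTc : Continuous T := by
    refine continuous_pi fun i => continuous_pi fun j => ?_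
    have : Continuous fun X : Matrix (Fin n) (Fin n) ℝ => P + N * X + U * (X * X) := by fun_prop
    exact ((continuous_apply j).comp ((continuous_apply i).comp this)).div_const _
  have hfix : T X = X := by
    have h1 : Filter.Tendsto (fun k => Z (k + 1)) Filter.atTop (nhds X) :=
      (Filter.tendsto_add_atTop_iff_nat 1).2 hlim
    have h2 : Filter.Tendsto (fun k => Z (k + 1)) Filter.atTop (nhds (T X)) := by
      simp only [hZs]
      exact (hTc.tendsto X).comp hlim
    exact tendsto_nhds_unique h2 h1
  refine ⟨X, ⟨fun i j => ge_of_tendsto' (hlime i j) fun k => hZnn k i j, (hTfix X).1 hfix, ?_⟩, ?_⟩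
  · intro Y hY hYeq i j
    have hYfix := (hTfix Y).2 hYeq
    refine le_of_tendsto' (hlime i j) fun k => ?_
    have : ∀ k i j, Z k i j ≤ Y i j := by
      intro k
      induction k with
      | zero => exact hY
      | succ k ih => rw [hZs, ← hYfix]; exact hTmono _ _ (hZnn k) ih
    exact this k i j
  · intro i
    have h1 : Filter.Tendsto (fun k => (Z k *ᵥ y) i) Filter.atTop (nhds ((X *ᵥ y) i)) := by
      simp only [mulVec_apply_eq_sum]
      exact tendsto_finsetSum _ fun j _ => (hlime i j).mul_const _
    exact le_of_tendsto' h1 fun k => hZy k i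

/-! ### Taboo probabilities, recurrence and invariant measures of jump chains -/

/-- Conservative transition rates `q` without absorbing states, where `q x` is supported in the
finite set `T x`. -/
structure IsLocalGenerator {S : Type*} (q : S → S → ℝ) (T : S → Finset S) : Prop where
  self_mem : ∀ x, x ∈ T x
  support : ∀ x z, z ∉ T x → q x z = 0
  off_nonneg : ∀ x z, x ≠ z → 0 ≤ q x z
  diag_neg : ∀ x, q x x < 0
  row_sum : ∀ x, ∑ z ∈ T x, q x z = 0

theorem IsLocalGenerator.sum_mul_eq {S : Type*} {q : S → S → ℝ} {T : S → Finset S}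
    (hq : IsLocalGenerator q T) (f : S → ℝ) (z : S) :
    ∑ y ∈ T z, q z y * f y = ∑ y ∈ T z, q z y * (f y - f z) := by
  simp only [mul_sub, Finset.sum_sub_distrib, ← Finset.sum_mul, hq.row_sum]
  ring

section JumpChain

variable {S : Type*} [DecidableEq S] {q : S → S → ℝ} {T : S → Finset S}

/-- One jump changes the mean of `f` by `(q f)(x) / (-q x x)`; this converts generator inequalities
into statements about the jump chain. -/
theorem tsum_jumpProb_mul (hq : IsLocalGenerator q T) {f : S → ℝ} (hf : ∀ z, 0 ≤ f z) (x : S) :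
    ∑' z, jumpProb q x z * ENNReal.ofReal (f z) =
      ENNReal.ofReal (f x + (∑ z ∈ T x, q x z * f z) / (-q x x)) := by
  have hx : 0 < -q x x := by linarith [hq.diag_neg x]
  have h1 : ∀ z, z ∉ (T x).erase x → jumpProb q x z * ENNReal.ofReal (f z) = 0 := by
    intro z hz
    by_cases hxz : x = z
    · simp [jumpProb, hxz]
    · have : z ∉ T x := fun h => hz (Finset.mem_erase.2 ⟨fun h => hxz h.symm, h⟩)
      simp [jumpProb, hxz, hq.support x z this]
  rw [tsum_eq_sum h1]
  have h2 : ∀ z ∈ (T x).erase x, jumpProb q x z * ENNReal.ofReal (f z) =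
      ENNReal.ofReal (q x z / (-q x x) * f z) := by
    intro z hz
    have hxz : x ≠ z := (Finset.ne_of_mem_erase hz).symm
    rw [jumpProb, if_neg hxz, ENNReal.ofReal_mul (div_nonneg (hq.off_nonneg x z hxz) hx.le)]
  rw [Finset.sum_congr rfl h2, ← ENNReal.ofReal_sum_of_nonneg]
  · congr 1
    rw [← Finset.add_sum_erase _ _ (hq.self_mem x), eq_comm, add_div, Finset.sum_div]
    have h3 : q x x * f x / (-q x x) = - f x := by
      rw [div_eq_iff hx.ne']; ring
    rw [h3, ← add_assoc, add_neg_cancel, zero_add]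
    exact Finset.sum_congr rfl fun z _ => by ring
  · intro z hz
    have hxz : x ≠ z := (Finset.ne_of_mem_erase hz).symm
    exact mul_nonneg (div_nonneg (hq.off_nonneg x z hxz) hx.le) (hf z)

theorem tsum_jumpProb (hq : IsLocalGenerator q T) (x : S) : ∑' z, jumpProb q x z = 1 := by
  have h := tsum_jumpProb_mul hq (f := fun _ => 1) (fun _ => zero_le_one) x
  simpa [hq.row_sum] using h

/-- Splits a jump according to whether it lands in `x`: `tabooProb` discards that mass, and the
second summand restores it. -/
theorem tsum_tabooProb_succ_mul (q : S → S → ℝ) (x : S) (m : ℕ) (h : S → ℝ≥0∞) :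
    ∑' y, tabooProb q x (m + 1) y * h y + (∑' z, tabooProb q x m z * jumpProb q z x) * h x =
      ∑' z, tabooProb q x m z * ∑' y, jumpProb q z y * h y := by
  have h1 : ∑' z, tabooProb q x m z * ∑' y, jumpProb q z y * h y =
      ∑' y, (∑' z, tabooProb q x m z * jumpProb q z y) * h y := by
    simp_rw [← ENNReal.tsum_mul_left, ← ENNReal.tsum_mul_right]
    rw [ENNReal.tsum_comm]
    simp_rw [mul_assoc]
  rw [h1, ENNReal.tsum_eq_add_tsum_ite x (f := fun y => (∑' z, _ * jumpProb q z y) * h y),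
    add_comm]
  congr 1
  refine tsum_congr fun y => ?_
  by_cases hy : y = x
  · simp [hy, tabooProb]
  · simp [hy, tabooProb]

theorem tsum_tabooProb_succ (hq : IsLocalGenerator q T) (x : S) (m : ℕ) :
    ∑' y, tabooProb q x (m + 1) y + ∑' z, tabooProb q x m z * jumpProb q z x =
      ∑' z, tabooProb q x m z := by
  have h := tsum_tabooProb_succ_mul q x m (fun _ => 1)
  simpa [tsum_jumpProb hq] using h

theorem tsum_tabooProb_zero_mul (q : S → S → ℝ) (x : S) (h : S → ℝ≥0∞) :
    ∑' y, tabooProb q x 0 y * h y = h x := by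
  rw [tsum_eq_single x]
  · simp [tabooProb]
  · intro y hy; simp [tabooProb, hy]

/-- Each jump only transfers mass from "not yet returned" to "returned". Recurrence thus means that
the first part tends to zero. -/
theorem tsum_tabooProb_add_sum (hq : IsLocalGenerator q T) (x : S) (M : ℕ) :
    ∑' y, tabooProb q x M y +
      ∑ m ∈ Finset.range M, ∑' z, tabooProb q x m z * jumpProb q z x = 1 := by
  induction M with
  | zero => simpa using tsum_tabooProb_zero_mul q x (fun _ => 1)
  | succ M ih =>
    rw [Finset.sum_range_succ, add_comm (∑ m ∈ Finset.range M, _), ← add_assoc,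
      tsum_tabooProb_succ hq, ih]

theorem returnProb_le_one (hq : IsLocalGenerator q T) (x : S) : returnProb q x ≤ 1 := by
  refine le_of_tendsto' (ENNReal.tendsto_nat_tsum _) fun M => ?_
  rw [← tsum_tabooProb_add_sum hq x M]
  exact le_add_self

theorem returnProb_eq_one_of_tendsto (hq : IsLocalGenerator q T) (x : S)
    (h : Filter.Tendsto (fun M => ∑' y, tabooProb q x M y) Filter.atTop (nhds 0)) :
    returnProb q x = 1 := by
  have h1 := h.add (ENNReal.tendsto_nat_tsum
    (fun m => ∑' z, tabooProb q x m z * jumpProb q z x))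
  simp only [tsum_tabooProb_add_sum hq, zero_add] at h1
  exact tendsto_nhds_unique h1 tendsto_const_nhds

/-- Expected number of visits to `z` by the jump chain started in `x` before it returns to `x`. -/
noncomputable def tabooGreen (q : S → S → ℝ) (x z : S) : ℝ≥0∞ := ∑' m, tabooProb q x m z

theorem tabooGreen_self (q : S → S → ℝ) (x : S) : tabooGreen q x x = 1 := by
  rw [tabooGreen, tsum_eq_single 0]
  · simp [tabooProb]
  · intro m hm
    obtain ⟨k, rfl⟩ := Nat.exists_eq_succ_of_ne_zero hm
    simp [tabooProb]

theorem tsum_tabooGreen_mul (q : S → S → ℝ) (x : S) (h : S → ℝ≥0∞) :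
    ∑' z, tabooGreen q x z * h z = ∑' m, ∑' z, tabooProb q x m z * h z := by
  simp_rw [tabooGreen, ← ENNReal.tsum_mul_right]
  exact ENNReal.tsum_comm

theorem returnProb_eq (q : S → S → ℝ) (x : S) :
    returnProb q x = ∑' z, tabooGreen q x z * jumpProb q z x :=
  (tsum_tabooGreen_mul q x fun z => jumpProb q z x).symm

theorem tabooGreen_of_ne (q : S → S → ℝ) {x y : S} (hy : y ≠ x) :
    tabooGreen q x y = ∑' z, tabooGreen q x z * jumpProb q z y := by
  rw [tsum_tabooGreen_mul, tabooGreen, tsum_eq_zero_add' ENNReal.summable]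
  simp [tabooProb, hy]

/-- Expected visits form an excessive measure: equality holds off `x`, and at `x` the left side is
the return probability. -/
theorem tsum_tabooGreen_le (hq : IsLocalGenerator q T) (x y : S) :
    ∑' z, tabooGreen q x z * jumpProb q z y ≤ tabooGreen q x y := by
  by_cases hy : y = x
  · subst hy
    rw [← returnProb_eq, tabooGreen_self]
    exact returnProb_le_one hq y
  · exact (tabooGreen_of_ne q hy).ge

theorem jumpProb_pos (hq : IsLocalGenerator q T) {x y : S} (h : 0 < q x y) :
    jumpProb q x y ≠ 0 := by
  have hxy : x ≠ y := by
    rintro rfl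
    exact absurd h (hq.diag_neg x).le.not_gt
  rw [jumpProb, if_neg hxy, ENNReal.ofReal_ne_zero_iff]
  exact div_pos h (by linarith [hq.diag_neg x])

/-- Excessiveness gives `g a * p a b ≤ g b`, so finiteness travels backwards along a path from `z`
to `x`, where `g = 1`. -/
theorem tabooGreen_ne_top (hq : IsLocalGenerator q T) (hirr : IrreducibleRates q) (x z : S) :
    tabooGreen q x z ≠ ⊤ := by
  refine Relation.ReflTransGen.head_induction_on (hirr z x) ?_ ?_
  · simp [tabooGreen_self]
  · intro a b hab _ ih htop
    have h1 : tabooGreen q x a * jumpProb q a b ≤ tabooGreen q x b :=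
      (ENNReal.le_tsum a).trans (tsum_tabooGreen_le hq x b)
    rw [htop, ENNReal.top_mul (jumpProb_pos hq hab), top_le_iff] at h1
    exact ih h1

theorem tabooGreen_ne_zero (hq : IsLocalGenerator q T) (hirr : IrreducibleRates q) (x z : S) :
    tabooGreen q x z ≠ 0 := by
  induction hirr x z with
  | refl => simp [tabooGreen_self]
  | @tail a b _ hab ih =>
    intro h0
    have h1 : tabooGreen q x a * jumpProb q a b ≤ tabooGreen q x b :=
      (ENNReal.le_tsum a).trans (tsum_tabooGreen_le hq x b)
    rw [h0, nonpos_iff_eq_zero, mul_eq_zero] at h1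
    exact h1.elim ih (jumpProb_pos hq hab)

/-- Foster's criterion for recurrence. -/
theorem returnProb_eq_one (hq : IsLocalGenerator q T) (hirr : IrreducibleRates q)
    {V : S → ℝ} (hV : ∀ z, 0 ≤ V z) (F : Finset S)
    (hsup : ∀ z, z ∉ F → ∑ y ∈ T z, q z y * V y ≤ 0)
    (hfin : ∀ L : ℝ, {z | V z < L}.Finite) (x : S) : returnProb q x = 1 := by
  apply returnProb_eq_one_of_tendsto hq
  set PV : S → ℝ≥0∞ := fun z => ∑' y, jumpProb q z y * ENNReal.ofReal (V y) with hPV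
  have hPVtop : ∀ z, PV z ≠ ⊤ := fun z => by
    simp only [hPV, tsum_jumpProb_mul hq hV]
    exact ENNReal.ofReal_ne_top
  -- `B` bounds the mean of `V` over the unreturned mass at all times: `V` can grow in mean only on
  -- `F`, which is visited finitely often in expectation.
  set B : ℝ≥0∞ := ENNReal.ofReal (V x) + ∑ z ∈ F, tabooGreen q x z * PV z with hB
  have hBtop : B ≠ ⊤ := by
    refine ENNReal.add_ne_top.2 ⟨ENNReal.ofReal_ne_top, ENNReal.sum_ne_top.2 fun z _ => ?_⟩
    exact ENNReal.mul_ne_top (tabooGreen_ne_top hq hirr x z) (hPVtop z)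
  have hPVle : ∀ z, PV z ≤ ENNReal.ofReal (V z) + if z ∈ F then PV z else 0 := by
    intro z
    by_cases hz : z ∈ F
    · simp [hz]
    · simp only [hz, if_false, add_zero]
      simp only [hPV, tsum_jumpProb_mul hq hV]
      apply ENNReal.ofReal_le_ofReal
      have := div_nonpos_of_nonpos_of_nonneg (hsup z hz) (by linarith [hq.diag_neg z] : 0 ≤ -q z z)
      linarith
  have hstep : ∀ M, ∑' z, tabooProb q x M z * ENNReal.ofReal (V z) ≤
      ENNReal.ofReal (V x) + ∑ m ∈ Finset.range M, ∑ z ∈ F, tabooProb q x m z * PV z := by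
    intro M
    induction M with
    | zero => simp [tsum_tabooProb_zero_mul]
    | succ M ih =>
      calc ∑' z, tabooProb q x (M + 1) z * ENNReal.ofReal (V z)
          ≤ ∑' z, tabooProb q x M z * PV z := by
            rw [hPV, ← tsum_tabooProb_succ_mul q x M fun z => ENNReal.ofReal (V z)]
            exact le_self_add
        _ ≤ ∑' z, (tabooProb q x M z * ENNReal.ofReal (V z) +
              if z ∈ F then tabooProb q x M z * PV z else 0) := by
            refine ENNReal.tsum_le_tsum fun z => ?_
            refine (mul_le_mul_right (hPVle z) _).trans_eq ?_
            rw [mul_add, mul_ite, mul_zero]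
        _ = ∑' z, tabooProb q x M z * ENNReal.ofReal (V z) +
              ∑ z ∈ F, tabooProb q x M z * PV z := by
            rw [ENNReal.tsum_add, tsum_eq_sum (s := F) (fun z hz => if_neg hz)]
            congr 1
            exact Finset.sum_congr rfl fun z hz => if_pos hz
        _ ≤ _ := by
            rw [Finset.sum_range_succ, ← add_assoc]
            exact add_le_add_left ih _
  have hbound : ∀ M, ∑' z, tabooProb q x M z * ENNReal.ofReal (V z) ≤ B := by
    intro M
    refine (hstep M).trans (add_le_add_right ?_ _)
    rw [Finset.sum_comm]
    refine Finset.sum_le_sum fun z _ => ?_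
    rw [← Finset.sum_mul]
    exact mul_le_mul_left (ENNReal.sum_le_tsum _) _
  rw [ENNReal.tendsto_nhds_zero]
  intro ε hε
  obtain ⟨L, hL⟩ : ∃ L : ℕ, 0 < L ∧ B / L ≤ ε / 2 := by
    obtain ⟨L, hL⟩ := ENNReal.exists_nat_mul_gt (ENNReal.half_pos hε.ne').ne' hBtop
    have hL0 : L ≠ 0 := by rintro rfl; simp at hL
    exact ⟨L, Nat.pos_of_ne_zero hL0, ENNReal.div_le_of_le_mul' hL.le⟩
  obtain ⟨hL0, hL⟩ := hL
  have hLR : (0 : ℝ) < L := by exact_mod_cast hL0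
  -- Outside the finite sublevel set `E`, Markov's inequality bounds the unreturned mass by `B / L`;
  -- inside, it tends to zero as the terms of convergent series.
  set E := (hfin L).toFinset with hE
  have hsplit : ∀ M, ∑' z, tabooProb q x M z ≤ ∑ z ∈ E, tabooProb q x M z + B / L := by
    intro M
    calc ∑' z, tabooProb q x M z
        ≤ ∑' z, ((if z ∈ E then tabooProb q x M z else 0) +
            tabooProb q x M z * ENNReal.ofReal (V z) / L) := by
          refine ENNReal.tsum_le_tsum fun z => ?_
          by_cases hz : z ∈ E
          · simp [hz]
          · have hVz : (L : ℝ) ≤ V z := by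
              simpa [hE] using hz
            simp only [hz, if_false, zero_add]
            rw [mul_div_assoc]
            refine le_mul_of_one_le_right zero_le ?_
            rw [ENNReal.le_div_iff_mul_le (Or.inl (by simpa using hL0.ne')) (Or.inl (by simp)),
              one_mul, ← ENNReal.ofReal_natCast]
            exact ENNReal.ofReal_le_ofReal hVz
      _ ≤ _ := by
          rw [ENNReal.tsum_add, tsum_eq_sum (s := E) (fun z hz => if_neg hz)]
          refine add_le_add (Finset.sum_congr rfl fun z hz => if_pos hz).le ?_
          simp only [div_eq_mul_inv, ENNReal.tsum_mul_right]
          exact mul_le_mul_left (hbound M) _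
  have hzero : Filter.Tendsto (fun M => ∑ z ∈ E, tabooProb q x M z) Filter.atTop (nhds 0) := by
    have : Filter.Tendsto (fun M => ∑ z ∈ E, tabooProb q x M z) Filter.atTop
        (nhds (∑ z ∈ E, 0)) := tendsto_finsetSum _ fun z _ =>
      ENNReal.tendsto_atTop_zero_of_tsum_ne_top (tabooGreen_ne_top hq hirr x z)
    simpa using this
  filter_upwards [(ENNReal.tendsto_nhds_zero.1 hzero) (ε / 2) (ENNReal.half_pos hε.ne')] with M hM
  calc _ ≤ _ := hsplit M
    _ ≤ ε / 2 + ε / 2 := add_le_add hM hL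
    _ = ε := ENNReal.add_halves ε

/-- A chain with finite mean return time to some state has a positive summable measure `μ` which
integrates the generator applied to any bounded function to zero. -/
theorem exists_invariant_measure (hq : IsLocalGenerator q T) (hirr : IrreducibleRates q)
    {K : ℝ} (hK : ∀ z, -q z z ≤ K) {x : S} (hret : returnProb q x = 1)
    (hmean : meanReturnTime q x ≠ ⊤) :
    ∃ μ : S → ℝ, (∀ z, 0 < μ z) ∧ Summable μ ∧
      ∀ (f : S → ℝ) (b : ℝ), (∀ z, 0 ≤ f z) → (∀ z, f z ≤ b) →
        ∑' z, μ z * ∑ y ∈ T z, q z y * f y = 0 := by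
  have hd : ∀ z, 0 < -q z z := fun z => by linarith [hq.diag_neg z]
  set g : S → ℝ := fun z => (tabooGreen q x z).toReal with hg
  have hgt : ∀ z, ENNReal.ofReal (g z) = tabooGreen q x z := fun z =>
    ENNReal.ofReal_toReal (tabooGreen_ne_top hq hirr x z)
  have hg0 : ∀ z, 0 < g z := fun z =>
    ENNReal.toReal_pos (tabooGreen_ne_zero hq hirr x z) (tabooGreen_ne_top hq hirr x z)
  have hμs : Summable fun z => g z * (1 / -q z z) := by
    have h1 : ∑' z, ENNReal.ofReal (g z * (1 / -q z z)) ≠ ⊤ := by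
      have : meanReturnTime q x = ∑' z, ENNReal.ofReal (g z * (1 / -q z z)) := by
        rw [meanReturnTime, ← tsum_tabooGreen_mul]
        refine tsum_congr fun z => ?_
        rw [ENNReal.ofReal_mul (hg0 z).le, hgt]
      rwa [← this]
    have h2 := ENNReal.summable_toReal h1
    refine h2.congr fun z => ENNReal.toReal_ofReal ?_
    exact mul_nonneg (hg0 z).le (one_div_nonneg.2 (hd z).le)
  -- The occupation times `g / (-q)` are summable by hypothesis; bounded rates carry this over to
  -- the visit counts `g`.
  have hgs : Summable g := by
    refine Summable.of_nonneg_of_le (fun z => (hg0 z).le) (fun z => ?_) (hμs.mul_left K)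
    rw [← mul_assoc, mul_one_div, le_div_iff₀ (hd z), mul_comm]
    exact mul_le_mul_of_nonneg_right (hK z) (hg0 z).le
  refine ⟨fun z => g z * (1 / -q z z), fun z => mul_pos (hg0 z) (one_div_pos.2 (hd z)), hμs, ?_⟩
  intro f b hf hfb
  -- Return probability one closes the excessive inequality at `x`, so `g` is invariant for the jump
  -- chain.
  have hinv : ∀ y, ∑' z, tabooGreen q x z * jumpProb q z y = tabooGreen q x y := by
    intro y
    by_cases hy : y = x
    · subst hy; rw [← returnProb_eq, tabooGreen_self, hret]
    · exact (tabooGreen_of_ne q hy).symm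
  -- `h` is the one-jump mean of `f`. Invariance gives `∑ g h = ∑ g f`, and `g (h - f)` is the
  -- occupation measure times the generator applied to `f`.
  set h : S → ℝ := fun z => f z + (∑ y ∈ T z, q z y * f y) / (-q z z) with hh
  have hEN : ∑' z, ENNReal.ofReal (g z * h z) = ∑' z, ENNReal.ofReal (g z * f z) := by
    have h1 : ∀ z, ENNReal.ofReal (g z * h z) =
        ∑' y, tabooGreen q x z * jumpProb q z y * ENNReal.ofReal (f y) := by
      intro z
      rw [ENNReal.ofReal_mul (hg0 z).le, hgt, hh, ← tsum_jumpProb_mul hq hf,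
        ← ENNReal.tsum_mul_left]
      simp_rw [mul_assoc]
    simp_rw [h1]
    rw [ENNReal.tsum_comm]
    refine tsum_congr fun y => ?_
    rw [ENNReal.tsum_mul_right, hinv, ← hgt, ENNReal.ofReal_mul (hg0 y).le]
  have hh0 : ∀ z, 0 ≤ h z := by
    intro z
    rw [hh]
    have : f z + (∑ y ∈ T z, q z y * f y) / (-q z z) =
        (∑ y ∈ (T z).erase z, q z y * f y) / (-q z z) := by
      rw [← Finset.add_sum_erase _ _ (hq.self_mem z), add_div]
      have h3 : q z z * f z / (-q z z) = - f z := by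
        rw [div_eq_iff (hd z).ne']; ring
      rw [h3, ← add_assoc, add_neg_cancel, zero_add]
    simp only [this]
    refine div_nonneg (Finset.sum_nonneg fun y hy => ?_) (hd z).le
    exact mul_nonneg (hq.off_nonneg z y (Finset.ne_of_mem_erase hy).symm) (hf y)
  have hfs : Summable fun z => g z * f z :=
    Summable.of_nonneg_of_le (fun z => mul_nonneg (hg0 z).le (hf z))
      (fun z => mul_le_mul_of_nonneg_left (hfb z) (hg0 z).le) (hgs.mul_right b)
  have hhs : Summable fun z => g z * h z := by
    have h1 : ∑' z, ENNReal.ofReal (g z * h z) ≠ ⊤ := by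
      rw [hEN, ← ENNReal.ofReal_tsum_of_nonneg (fun z => mul_nonneg (hg0 z).le (hf z)) hfs]
      exact ENNReal.ofReal_ne_top
    refine (ENNReal.summable_toReal h1).congr fun z => ENNReal.toReal_ofReal ?_
    exact mul_nonneg (hg0 z).le (hh0 z)
  have hR : ∑' z, g z * h z = ∑' z, g z * f z := by
    rw [← ENNReal.ofReal_tsum_of_nonneg (fun z => mul_nonneg (hg0 z).le (hf z)) hfs,
      ← ENNReal.ofReal_tsum_of_nonneg (fun z => mul_nonneg (hg0 z).le (hh0 z)) hhs] at hEN
    exact (ENNReal.ofReal_eq_ofReal_iff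
      (tsum_nonneg fun z => mul_nonneg (hg0 z).le (hh0 z))
      (tsum_nonneg fun z => mul_nonneg (hg0 z).le (hf z))).1 hEN
  have h4 : ∀ z, g z * (1 / -q z z) * ∑ y ∈ T z, q z y * f y = g z * h z - g z * f z := by
    intro z; rw [hh]; ring
  simp_rw [h4]
  rw [hhs.tsum_sub hfs, hR, sub_self]

end JumpChain

/-! ### Subharmonic functions that exclude positive recurrence -/

section NullRecurrence

variable {S : Type*} [DecidableEq S] {q : S → S → ℝ} {T : S → Finset S}

/-- Provides the dominating bound, uniform over truncations of `f`, for passing to the limit under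
the invariant measure. -/
theorem IsLocalGenerator.abs_sum_mul_le (hq : IsLocalGenerator q T) {f : S → ℝ} {J K : ℝ}
    (hK : ∀ z, -q z z ≤ K) (hf : ∀ z, ∀ y ∈ T z, |f y - f z| ≤ J) (z : S) :
    |∑ y ∈ T z, q z y * f y| ≤ K * J := by
  have hJ : 0 ≤ J := (abs_nonneg _).trans (hf z z (hq.self_mem z))
  have hs := hq.row_sum z
  rw [← Finset.add_sum_erase _ _ (hq.self_mem z)] at hs
  rw [hq.sum_mul_eq, ← Finset.add_sum_erase _ _ (hq.self_mem z), sub_self, mul_zero, zero_add]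
  calc |∑ y ∈ (T z).erase z, q z y * (f y - f z)|
      ≤ ∑ y ∈ (T z).erase z, |q z y * (f y - f z)| := Finset.abs_sum_le_sum_abs _ _
    _ ≤ ∑ y ∈ (T z).erase z, q z y * J := by
        refine Finset.sum_le_sum fun y hy => ?_
        have h0 := hq.off_nonneg z y (Finset.ne_of_mem_erase hy).symm
        rw [abs_mul, abs_of_nonneg h0]
        exact mul_le_mul_of_nonneg_left (hf z y (Finset.mem_of_mem_erase hy)) h0
    _ = (-q z z) * J := by rw [← Finset.sum_mul]; congr 1; linarith
    _ ≤ K * J := mul_le_mul_of_nonneg_right (hK z) hJ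

/-- If `V z ≤ c`, the positive part vanishes at `z` and is nonnegative elsewhere; if `V z > c`, it
equals `V - c` at `z` and dominates it elsewhere. -/
theorem IsLocalGenerator.posPart_subharmonic (hq : IsLocalGenerator q T) {V : S → ℝ} {c : ℝ}
    {z : S} (hz : V z ≤ c ∨ 0 ≤ ∑ y ∈ T z, q z y * V y) :
    0 ≤ ∑ y ∈ T z, q z y * max (V y - c) 0 := by
  rcases le_or_gt (V z) c with h | h
  · refine Finset.sum_nonneg fun y _ => ?_
    by_cases hy : z = y
    · subst hy; simp [max_eq_right (sub_nonpos.2 h)]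
    · exact mul_nonneg (hq.off_nonneg z y hy) (le_max_right _ _)
  · have h1 := hz.resolve_left (not_le.2 h)
    rw [hq.sum_mul_eq] at h1
    rw [hq.sum_mul_eq (fun y => max (V y - c) 0)]
    refine h1.trans (Finset.sum_le_sum fun y _ => ?_)
    by_cases hy : z = y
    · subst hy; simp
    · refine mul_le_mul_of_nonneg_left ?_ (hq.off_nonneg z y hy)
      have := le_max_left (V y - c) 0
      rw [max_eq_left (sub_pos.2 h).le]
      linarith

/-- A nonconstant nonnegative subharmonic function with bounded increments and a zero rules out
positive recurrence. -/
theorem meanReturnTime_eq_top (hq : IsLocalGenerator q T) (hirr : IrreducibleRates q)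
    {K J : ℝ} (hK : ∀ z, -q z z ≤ K) {f : S → ℝ} (hf : ∀ z, 0 ≤ f z)
    (hJ : ∀ z, ∀ y ∈ T z, |f y - f z| ≤ J) (hsub : ∀ z, 0 ≤ ∑ y ∈ T z, q z y * f y)
    {z₀ z₁ : S} (h0 : f z₀ = 0) (h1 : f z₁ ≠ 0) {x : S} (hret : returnProb q x = 1) :
    meanReturnTime q x = ⊤ := by
  by_contra hmean
  obtain ⟨μ, hμ, hμs, hinv⟩ := exists_invariant_measure hq hirr hK hret hmean
  have hlip : ∀ (N : ℕ) z, ∀ y ∈ T z, |min (f y) N - min (f z) N| ≤ J := fun N z y hy =>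
    (abs_min_sub_min_le_max _ _ _ _).trans
      (max_le (hJ z y hy) (by simpa using (abs_nonneg _).trans (hJ z y hy)))
  have hbd : ∀ (N : ℕ) z, ‖μ z * ∑ y ∈ T z, q z y * min (f y) N‖ ≤ μ z * (K * J) := by
    intro N z
    rw [norm_mul, Real.norm_of_nonneg (hμ z).le]
    exact mul_le_mul_of_nonneg_left (hq.abs_sum_mul_le hK (hlip N) z) (hμ z).le
  -- Each truncation is bounded, hence integrates to zero; dominated convergence extends this to
  -- `f`. Since `μ > 0` and `q f ≥ 0`, `f` must be harmonic.
  have hlim : Filter.Tendsto (fun N : ℕ => ∑' z, μ z * ∑ y ∈ T z, q z y * min (f y) N)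
      Filter.atTop (nhds (∑' z, μ z * ∑ y ∈ T z, q z y * f y)) := by
    refine tendsto_tsum_of_dominated_convergence (hμs.mul_right (K * J)) (fun z => ?_)
      (Filter.Eventually.of_forall hbd)
    refine Filter.Tendsto.const_mul _ (tendsto_finsetSum _ fun y _ => Filter.Tendsto.const_mul _ ?_)
    refine tendsto_const_nhds.congr' ?_
    obtain ⟨N, hN⟩ := exists_nat_ge (f y)
    filter_upwards [Filter.eventually_ge_atTop N] with M hM
    exact (min_eq_left (hN.trans (by exact_mod_cast hM))).symm
  have hz : ∀ N : ℕ, ∑' z, μ z * ∑ y ∈ T z, q z y * min (f y) N = 0 := fun N =>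
    hinv (fun y => min (f y) N) N (fun z => le_min (hf z) (Nat.cast_nonneg N))
      (fun z => min_le_right _ _)
  simp only [hz] at hlim
  have htot := (tendsto_nhds_unique hlim tendsto_const_nhds)
  have hsm : Summable fun z => μ z * ∑ y ∈ T z, q z y * f y := by
    refine Summable.of_norm_bounded (hμs.mul_right (K * J)) fun z => ?_
    rw [norm_mul, Real.norm_of_nonneg (hμ z).le]
    exact mul_le_mul_of_nonneg_left (hq.abs_sum_mul_le hK hJ z) (hμ z).le
  have hharm : ∀ z, ∑ y ∈ T z, q z y * f y = 0 := by
    intro z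
    have h2 := (hsm.hasSum_iff.2 htot)
    rw [hasSum_zero_iff_of_nonneg fun z => mul_nonneg (hμ z).le (hsub z)] at h2
    exact (mul_eq_zero.1 (congrFun h2 z)).resolve_left (hμ z).ne'
  -- At a zero of `f`, harmonicity equates a sum of nonnegative terms to zero, so zeros spread along
  -- all transitions from `z₀` to `z₁`.
  apply h1
  induction hirr z₀ z₁ with
  | refl => exact h0
  | @tail a b _ hab ih =>
    have hterm : ∀ y ∈ T a, 0 ≤ q a y * f y := by
      intro y _
      by_cases hy : a = y
      · subst hy
        have ha : f a = 0 := by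
          by_contra h'
          exact h' (ih h')
        rw [ha, mul_zero]
      · exact mul_nonneg (hq.off_nonneg a y hy) (hf y)
    have hb : b ∈ T a := by
      by_contra h
      exact hab.ne' (hq.support a b h)
    have := (Finset.sum_eq_zero_iff_of_nonneg hterm).1 (hharm a) b hb
    exact (mul_eq_zero.1 this).resolve_left hab.ne'

end NullRecurrence

/-! ### Zero drift makes the unrestricted process null recurrent -/

section UnrestrictedQBD

variable {n : ℕ} {Am A0 Ap B0 C0 : Matrix (Fin n) (Fin n) ℝ}

/-- The states on levels adjacent to the level of a given state. -/
def adjacentStates (n : ℕ) (x : ℕ × Fin n) : Finset (ℕ × Fin n) :=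
  Finset.Icc (x.1 - 1) (x.1 + 1) ×ˢ Finset.univ

theorem sum_adjacentStates_zero (Am A0 Ap B0 : Matrix (Fin n) (Fin n) ℝ) (f : ℕ × Fin n → ℝ)
    (i : Fin n) :
    ∑ y ∈ adjacentStates n (0, i), unrestrictedQBD Am A0 Ap B0 (0, i) y * f y =
      ∑ j, (B0 i j * f (0, j) + Ap i j * f (1, j)) := by
  have h : Finset.Icc (0 - 1) (0 + 1) = ({0, 1} : Finset ℕ) := by decide
  rw [adjacentStates, Finset.sum_product, h, Finset.sum_pair (by decide),
    ← Finset.sum_add_distrib]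
  simp [unrestrictedQBD]

theorem sum_adjacentStates_succ (Am A0 Ap B0 : Matrix (Fin n) (Fin n) ℝ) (f : ℕ × Fin n → ℝ)
    (k : ℕ) (i : Fin n) :
    ∑ y ∈ adjacentStates n (k + 1, i), unrestrictedQBD Am A0 Ap B0 (k + 1, i) y * f y =
      ∑ j, (Am i j * f (k, j) + A0 i j * f (k + 1, j) + Ap i j * f (k + 2, j)) := by
  have h : Finset.Icc (k + 1 - 1) (k + 1 + 1) = ({k, k + 1, k + 2} : Finset ℕ) := by
    ext m; simp only [Finset.mem_Icc, Finset.mem_insert, Finset.mem_singleton]; omega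
  rw [adjacentStates, Finset.sum_product, h, Finset.sum_insert (by simp),
    Finset.sum_pair (by simp), ← Finset.sum_add_distrib, ← Finset.sum_add_distrib]
  refine Finset.sum_congr rfl fun j _ => ?_
  simp [unrestrictedQBD, add_assoc]

theorem isLocalGenerator_unrestrictedQBD (h : IsQBD Am A0 Ap B0 C0)
    (hunr : IrreducibleRates (unrestrictedQBD Am A0 Ap B0)) :
    IsLocalGenerator (unrestrictedQBD Am A0 Ap B0) (adjacentStates n) := by
  have hself : ∀ x, x ∈ adjacentStates n x := fun x => by
    simp only [adjacentStates, Finset.mem_product, Finset.mem_Icc, Finset.mem_univ, and_true]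
    omega
  have hoff : ∀ x z, x ≠ z → 0 ≤ unrestrictedQBD Am A0 Ap B0 x z := by
    rintro ⟨k, i⟩ ⟨l, j⟩ hne
    simp only [unrestrictedQBD]
    split_ifs with h1 h2 h3 h4
    · exact h.up_nonneg i j
    · exact h.down_nonneg i j
    · exact h.lower_nonneg i j fun hij => hne (by rw [h3, hij])
    · exact h.mid_nonneg i j fun hij => hne (by rw [h3, hij])
    · exact le_rfl
  have hsupp : ∀ x z, z ∉ adjacentStates n x → unrestrictedQBD Am A0 Ap B0 x z = 0 := by
    rintro ⟨k, i⟩ ⟨l, j⟩ hz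
    simp only [adjacentStates, Finset.mem_product, Finset.mem_Icc, Finset.mem_univ, and_true] at hz
    simp only [unrestrictedQBD]
    rw [if_neg (by omega), if_neg (by omega), if_neg (by omega)]
  have hsum : ∀ x, ∑ z ∈ adjacentStates n x, unrestrictedQBD Am A0 Ap B0 x z = 0 := by
    rintro ⟨k, i⟩
    cases k with
    | zero => simpa [h.lower_sum] using sum_adjacentStates_zero Am A0 Ap B0 (fun _ => 1) i
    | succ k => simpa [h.mid_sum] using sum_adjacentStates_succ Am A0 Ap B0 (fun _ => 1) k i
  refine ⟨hself, hsupp, hoff, fun x => ?_, hsum⟩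
  have hs := hsum x
  rw [← Finset.add_sum_erase _ _ (hself x)] at hs
  have hnn : ∀ z ∈ (adjacentStates n x).erase x, 0 ≤ unrestrictedQBD Am A0 Ap B0 x z :=
    fun z hz => hoff x z (Finset.ne_of_mem_erase hz).symm
  -- Any state other than `x` would do: a path to it must leave `x` at a positive rate, making the
  -- diagonal entry strictly negative.
  obtain ⟨y, hy⟩ : ∃ y, y ≠ x := ⟨(x.1 + 1, x.2), fun h => by simpa using congrArg Prod.fst h⟩
  have hdle : unrestrictedQBD Am A0 Ap B0 x x ≤ 0 := by
    have := Finset.sum_nonneg hnn; linarith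
  rcases Relation.ReflTransGen.cases_head (hunr x y) with h' | ⟨z, hxz, -⟩
  · exact absurd h'.symm hy
  · have hzx : z ≠ x := by rintro rfl; exact hdle.not_gt hxz
    have hz : z ∈ (adjacentStates n x).erase x := by
      refine Finset.mem_erase.2 ⟨hzx, ?_⟩
      by_contra hz
      exact hxz.ne' (hsupp x z hz)
    have := Finset.single_le_sum hnn hz
    linarith

/-- If the phases can be weighted so that level plus weight has no drift away from level zero,
then the unrestricted process is null recurrent. -/
theorem isNullRecurrent_of_drift_eq_zero (hn : 0 < n) (h : IsQBD Am A0 Ap B0 C0)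
    (hunr : IrreducibleRates (unrestrictedQBD Am A0 Ap B0)) {w : Fin n → ℝ}
    (hw : ∀ i, ((Am + A0 + Ap) *ᵥ w) i + ∑ j, (Ap i j - Am i j) = 0) :
    IsNullRecurrent (unrestrictedQBD Am A0 Ap B0) := by
  have hq := isLocalGenerator_unrestrictedQBD h hunr
  set c : ℝ := ∑ i, |w i| with hc
  have hwc : ∀ i, |w i| ≤ c := fun i =>
    Finset.single_le_sum (f := fun i => |w i|) (fun _ _ => abs_nonneg _) (Finset.mem_univ i)
  -- The shift `c` places `V` between the level and the level plus `2 c`, so `V ≥ 0` has finite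
  -- sublevel sets.
  set V : ℕ × Fin n → ℝ := fun x => x.1 + w x.2 + c with hV
  have hVlow : ∀ x : ℕ × Fin n, (x.1 : ℝ) ≤ V x := fun x => by
    have := neg_abs_le (w x.2); have := hwc x.2; simp only [hV]; linarith
  have hVup : ∀ x : ℕ × Fin n, V x ≤ x.1 + 2 * c := fun x => by
    have := le_abs_self (w x.2); have := hwc x.2; simp only [hV]; linarith
  have hharm : ∀ k i, ∑ y ∈ adjacentStates n (k + 1, i),
      unrestrictedQBD Am A0 Ap B0 (k + 1, i) y * V y = 0 := by
    intro k i
    rw [sum_adjacentStates_succ]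
    have h1 : ∀ j, Am i j * V (k, j) + A0 i j * V (k + 1, j) + Ap i j * V (k + 2, j) =
        (Am i j + A0 i j + Ap i j) * (k + 1 + c) + ((Am + A0 + Ap) i j * w j +
          (Ap i j - Am i j)) := by
      intro j
      simp only [hV, Matrix.add_apply]
      push_cast
      ring
    rw [Finset.sum_congr rfl fun j _ => h1 j, Finset.sum_add_distrib, ← Finset.sum_mul,
      h.mid_sum, zero_mul, zero_add, Finset.sum_add_distrib]
    exact hw i
  have hret : ∀ x, returnProb (unrestrictedQBD Am A0 Ap B0) x = 1 := by
    refine returnProb_eq_one hq hunr (V := V) (fun z => (Nat.cast_nonneg _).trans (hVlow z))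
      ({0} ×ˢ Finset.univ) ?_ ?_
    · rintro ⟨k, i⟩ hk
      cases k with
      | zero => simp at hk
      | succ k => exact (hharm k i).le
    · intro L
      refine (Finset.finite_toSet (Finset.range ⌈L⌉₊ ×ˢ (Finset.univ : Finset (Fin n)))).subset ?_
      intro x hx
      have : (x.1 : ℝ) < L := (hVlow x).trans_lt hx
      simpa using Nat.lt_ceil.2 this
  refine fun x => ⟨hret x, ?_⟩
  have hKi : ∀ z : ℕ × Fin n, -unrestrictedQBD Am A0 Ap B0 z z ≤ ∑ i, (|B0 i i| + |A0 i i|) := by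
    rintro ⟨k, i⟩
    refine le_trans ?_ (Finset.single_le_sum (f := fun i => |B0 i i| + |A0 i i|)
      (fun _ _ => by positivity) (Finset.mem_univ i))
    have h1 := neg_le_abs (B0 i i)
    have h2 := neg_le_abs (A0 i i)
    have h3 := abs_nonneg (B0 i i)
    have h4 := abs_nonneg (A0 i i)
    by_cases hk : k = 0
    · simp [unrestrictedQBD, hk]; linarith
    · simp [unrestrictedQBD, hk]; linarith
  have hc0 : 0 ≤ c := Finset.sum_nonneg fun _ _ => abs_nonneg _
  -- Cutting at `2 c` kills `V` on level `0`, the only level where it may fail to be harmonic. A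
  -- step changes the level by at most `1` and the weight by at most `2 c`; at `z₁` the level
  -- already exceeds `2 c`.
  refine meanReturnTime_eq_top (J := 1 + 2 * c) (z₀ := (0, ⟨0, hn⟩)) (z₁ := (⌈2 * c⌉₊ + 1, ⟨0, hn⟩))
    (f := fun z => max (V z - 2 * c) 0) hq hunr hKi (fun z => le_max_right _ _) ?_ ?_ ?_ ?_ (hret x)
  · intro z y hy
    refine (abs_max_sub_max_le_max _ _ _ _).trans ?_
    simp only [adjacentStates, Finset.mem_product, Finset.mem_Icc, Finset.mem_univ,
      and_true] at hy
    have h1 : (y.1 : ℝ) ≤ z.1 + 1 := by exact_mod_cast hy.2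
    have h2 : (z.1 : ℝ) ≤ y.1 + 1 := by
      have : z.1 ≤ y.1 + 1 := by omega
      exact_mod_cast this
    have h3 := abs_le.1 (hwc y.2)
    have h4 := abs_le.1 (hwc z.2)
    refine max_le (abs_le.2 ⟨?_, ?_⟩) (by simp; linarith) <;> simp only [hV] <;> linarith
  · rintro ⟨k, i⟩
    refine hq.posPart_subharmonic ?_
    cases k with
    | zero => left; simpa using hVup (0, i)
    | succ k => right; exact (hharm k i).ge
  · have := hVup (0, ⟨0, hn⟩)
    simp only [Nat.cast_zero, zero_add] at this
    exact max_eq_right (by linarith)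
  · have h1 := hVlow (⌈2 * c⌉₊ + 1, ⟨0, hn⟩)
    have h2 := Nat.le_ceil (2 * c)
    push_cast at h1
    exact (lt_max_of_lt_left (by linarith)).ne'

end UnrestrictedQBD

/-! ### Drift and geometric superharmonic functions -/

/-- The drift of the level process, together with a solution of the associated Poisson equation. -/
theorem exists_drift {n : ℕ} {Am A0 Ap B0 C0 : Matrix (Fin n) (Fin n) ℝ}
    (h : IsQBD Am A0 Ap B0 C0) (hphase : IrreducibleRates (Am + A0 + Ap)) :
    ∃ (w : Fin n → ℝ) (d : ℝ), ∀ i,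
      ((Am + A0 + Ap) *ᵥ w) i + ∑ j, (Ap i j - Am i j) = d := by
  have hU := isUnit_add_ones (Q := Am + A0 + Ap)
    (fun i j hij => add_nonneg (add_nonneg (h.down_nonneg i j) (h.mid_nonneg i j hij))
      (h.up_nonneg i j)) h.mid_sum hphase
  obtain ⟨w, hw⟩ := (Matrix.mulVec_surjective_iff_isUnit.2 hU) (fun i => ∑ j, (Am i j - Ap i j))
  refine ⟨w, -∑ j, w j, fun i => ?_⟩
  have h1 := congrFun hw i
  simp only [Matrix.add_mulVec, Pi.add_apply] at h1 ⊢
  have h2 : ((Matrix.of fun _ _ => (1 : ℝ)) *ᵥ w : Fin n → ℝ) i = ∑ j, w j := by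
    simp [Matrix.mulVec, dotProduct]
  rw [h2] at h1
  simp only [Finset.sum_sub_distrib] at h1 ⊢
  linarith

/-- If the drift does not vanish, some geometric function is strictly superharmonic. -/
theorem exists_geometric_superharmonic {n : ℕ} {Am A0 Ap B0 C0 : Matrix (Fin n) (Fin n) ℝ}
    (h : IsQBD Am A0 Ap B0 C0) {w : Fin n → ℝ} {d : ℝ} (hd : d ≠ 0)
    (hw : ∀ i, ((Am + A0 + Ap) *ᵥ w) i + ∑ j, (Ap i j - Am i j) = d) :
    ∃ (x : ℝ) (y : Fin n → ℝ), 0 < x ∧ (∀ i, 0 < y i) ∧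
      ∀ i, (Am *ᵥ y) i + x * (A0 *ᵥ y) i + x ^ 2 * (Ap *ᵥ y) i < 0 := by
  -- Perturb `x = 1`, `y = 1`, where the expression vanishes, to `x = 1 - t`, `y = 1 - t w`. By the
  -- Poisson equation the first-order term is `-d t`, so a small `t` with the sign of `d` works.
  have hexp : ∀ t i, (Am *ᵥ (fun j => 1 - t * w j)) i + (1 - t) * (A0 *ᵥ (fun j => 1 - t * w j)) i
      + (1 - t) ^ 2 * (Ap *ᵥ (fun j => 1 - t * w j)) i =
      t * (-d + t * ((A0 *ᵥ w) i + 2 * (Ap *ᵥ w) i + ∑ j, Ap i j - t * (Ap *ᵥ w) i)) := by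
    intro t i
    have hM : ∀ M : Matrix (Fin n) (Fin n) ℝ, (M *ᵥ (fun j => 1 - t * w j)) i =
        ∑ j, M i j - t * (M *ᵥ w) i := by
      intro M
      simp only [mulVec_apply_eq_sum, Finset.mul_sum, ← Finset.sum_sub_distrib]
      exact Finset.sum_congr rfl fun j _ => by ring
    have h1 := h.mid_sum i
    have h2 := hw i
    simp only [Finset.sum_add_distrib, Finset.sum_sub_distrib, Matrix.add_mulVec,
      Pi.add_apply] at h1 h2
    rw [hM, hM, hM]
    have h3 : ∑ j, A0 i j = - ∑ j, Am i j - ∑ j, Ap i j := by linarith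
    rw [h3, ← h2]
    ring
  have hpos : ∀ i, ∀ᶠ t in nhds (0 : ℝ), 0 < 1 - t * w i := fun i => by
    have : Filter.Tendsto (fun t : ℝ => 1 - t * w i) (nhds 0) (nhds (1 - 0 * w i)) :=
      Continuous.tendsto (by fun_prop) 0
    exact this.eventually (lt_mem_nhds (by simp))
  have hx : ∀ᶠ t in nhds (0 : ℝ), 0 < 1 - t := by
    have : Filter.Tendsto (fun t : ℝ => 1 - t) (nhds 0) (nhds (1 - 0)) :=
      Continuous.tendsto (by fun_prop) 0
    exact this.eventually (lt_mem_nhds (by simp))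
  have hlim : ∀ i, Filter.Tendsto (fun t : ℝ => -d + t * ((A0 *ᵥ w) i + 2 * (Ap *ᵥ w) i +
      ∑ j, Ap i j - t * (Ap *ᵥ w) i)) (nhds 0) (nhds (-d)) := fun i => by
    have : Filter.Tendsto (fun t : ℝ => -d + t * ((A0 *ᵥ w) i + 2 * (Ap *ᵥ w) i +
      ∑ j, Ap i j - t * (Ap *ᵥ w) i)) (nhds 0) (nhds (-d + 0 * ((A0 *ᵥ w) i + 2 * (Ap *ᵥ w) i +
      ∑ j, Ap i j - 0 * (Ap *ᵥ w) i))) := Continuous.tendsto (by fun_prop) 0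
    simpa using this
  have key : ∃ t : ℝ, 0 < 1 - t ∧ (∀ i, 0 < 1 - t * w i) ∧ ∀ i,
      t * (-d + t * ((A0 *ᵥ w) i + 2 * (Ap *ᵥ w) i + ∑ j, Ap i j - t * (Ap *ᵥ w) i)) < 0 := by
    rcases hd.lt_or_gt with hd | hd
    · have h1 : ∀ᶠ t in nhds (0 : ℝ), ∀ i, 0 < -d + t * ((A0 *ᵥ w) i + 2 * (Ap *ᵥ w) i +
          ∑ j, Ap i j - t * (Ap *ᵥ w) i) :=
        Filter.eventually_all.2 fun i => (hlim i).eventually (lt_mem_nhds (by linarith))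
      have h2 := (hx.and ((Filter.eventually_all.2 hpos).and h1)).filter_mono
        (nhdsWithin_le_nhds (s := Set.Iio 0))
      obtain ⟨t, ⟨h3, h4, h5⟩, h6⟩ := (h2.and self_mem_nhdsWithin).exists
      exact ⟨t, h3, h4, fun i => mul_neg_of_neg_of_pos h6 (h5 i)⟩
    · have h1 : ∀ᶠ t in nhds (0 : ℝ), ∀ i, -d + t * ((A0 *ᵥ w) i + 2 * (Ap *ᵥ w) i +
          ∑ j, Ap i j - t * (Ap *ᵥ w) i) < 0 :=
        Filter.eventually_all.2 fun i => (hlim i).eventually (gt_mem_nhds (by linarith))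
      have h2 := (hx.and ((Filter.eventually_all.2 hpos).and h1)).filter_mono
        (nhdsWithin_le_nhds (s := Set.Ioi 0))
      obtain ⟨t, ⟨h3, h4, h5⟩, h6⟩ := (h2.and self_mem_nhdsWithin).exists
      exact ⟨t, h3, h4, fun i => mul_neg_of_pos_of_neg h6 (h5 i)⟩
  obtain ⟨t, h1, h2, h3⟩ := key
  exact ⟨1 - t, fun j => 1 - t * w j, h1, h2, fun i => by rw [hexp]; exact h3 i⟩

/-! ### Matrix-geometric vectors and the boundary system -/

section FiniteQBD

variable {n : ℕ} {Am A0 Ap B0 C0 : Matrix (Fin n) (Fin n) ℝ}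

/-- The blocks of the generator of the finite QBD process. -/
def finiteBlock (C : ℕ) (Am A0 Ap B0 C0 : Matrix (Fin n) (Fin n) ℝ) (k l : ℕ) :
    Matrix (Fin n) (Fin n) ℝ :=
  if l = k + 1 then Ap else if k = l + 1 then Am
  else if k = l then (if k = 0 then B0 else if k = C then C0 else A0) else 0

theorem finiteQBD_apply (C : ℕ) (Am A0 Ap B0 C0 : Matrix (Fin n) (Fin n) ℝ)
    (x y : Fin (C + 1) × Fin n) :
    finiteQBD C Am A0 Ap B0 C0 x y = finiteBlock C Am A0 Ap B0 C0 x.1 y.1 x.2 y.2 := by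
  simp only [finiteQBD, finiteBlock]
  split_ifs <;> rfl

theorem sum_eq_sum_adjacent {M : Type*} [AddCommMonoid M] {c m : ℕ} (hm : m < c) (F : ℕ → M)
    (hF : ∀ k, k ≠ m → k ≠ m + 1 → k ≠ m + 2 → F k = 0) :
    ∑ k ∈ Finset.range (c + 2), F k = F m + F (m + 1) + F (m + 2) := by
  rw [← Finset.sum_subset (s₁ := {m, m + 1, m + 2}), Finset.sum_insert (by simp),
    Finset.sum_pair (by simp), add_assoc]
  · intro k hk
    simp only [Finset.mem_insert, Finset.mem_singleton] at hk
    rw [Finset.mem_range]; omega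
  · intro k _ hk
    simp only [Finset.mem_insert, Finset.mem_singleton, not_or] at hk
    exact hF k hk.1 hk.2.1 hk.2.2

theorem sum_eq_sum_first {M : Type*} [AddCommMonoid M] {c : ℕ} (F : ℕ → M)
    (hF : ∀ k, k ≠ 0 → k ≠ 1 → F k = 0) :
    ∑ k ∈ Finset.range (c + 2), F k = F 0 + F 1 := by
  rw [← Finset.sum_subset (s₁ := {0, 1}), Finset.sum_pair (by simp)]
  · intro k hk
    simp only [Finset.mem_insert, Finset.mem_singleton] at hk
    rw [Finset.mem_range]; omega
  · intro k _ hk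
    simp only [Finset.mem_insert, Finset.mem_singleton, not_or] at hk
    exact hF k hk.1 hk.2

theorem sum_eq_sum_last {M : Type*} [AddCommMonoid M] {c : ℕ} (F : ℕ → M)
    (hF : ∀ k, k < c → F k = 0) :
    ∑ k ∈ Finset.range (c + 2), F k = F c + F (c + 1) := by
  rw [Finset.sum_range_succ, Finset.sum_range_succ,
    Finset.sum_eq_zero fun k hk => hF k (Finset.mem_range.1 hk), zero_add]

theorem finiteQBD_off_nonneg (h : IsQBD Am A0 Ap B0 C0) {C : ℕ} (x y : Fin (C + 1) × Fin n)
    (hxy : x ≠ y) : 0 ≤ finiteQBD C Am A0 Ap B0 C0 x y := by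
  obtain ⟨k, i⟩ := x
  obtain ⟨l, j⟩ := y
  simp only [finiteQBD]
  split_ifs with h1 h2 h3 h4 h5
  · exact h.up_nonneg i j
  · exact h.down_nonneg i j
  · exact h.lower_nonneg i j fun hij => hxy (by rw [Fin.ext h3, hij])
  · exact h.upper_nonneg i j fun hij => hxy (by rw [Fin.ext h3, hij])
  · exact h.mid_nonneg i j fun hij => hxy (by rw [Fin.ext h3, hij])
  · exact le_rfl

theorem finiteQBD_sum_eq_zero (h : IsQBD Am A0 Ap B0 C0) {c : ℕ} (x : Fin (c + 2) × Fin n) :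
    ∑ y, finiteQBD (c + 1) Am A0 Ap B0 C0 x y = 0 := by
  obtain ⟨⟨k, hk⟩, i⟩ := x
  simp only [finiteQBD_apply, Fintype.sum_prod_type]
  rw [Fin.sum_univ_eq_sum_range
    (fun l => ∑ j, finiteBlock (c + 1) Am A0 Ap B0 C0 k l i j) (c + 2)]
  have hz : ∀ l, l ≠ k + 1 → k ≠ l + 1 → k ≠ l →
      ∑ j, finiteBlock (c + 1) Am A0 Ap B0 C0 k l i j = 0 := by
    intro l h1 h2 h3
    simp [finiteBlock, h1, h2, h3]
  rcases Nat.eq_zero_or_pos k with rfl | hk0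
  · rw [sum_eq_sum_first _ fun l _ _ => hz l (by omega) (by omega) (by omega),
      ← Finset.sum_add_distrib]
    simpa [finiteBlock] using h.lower_sum i
  obtain ⟨m, rfl⟩ := Nat.exists_eq_add_of_lt hk0
  simp only [zero_add] at *
  rcases Nat.lt_or_ge m c with hm | hm
  · rw [sum_eq_sum_adjacent hm _ fun l _ _ _ => hz l (by omega) (by omega) (by omega),
      ← Finset.sum_add_distrib, ← Finset.sum_add_distrib]
    simpa [finiteBlock, hm.ne, show m ≠ m + 1 + 1 by omega] using h.mid_sum i
  · obtain rfl : m = c := by omega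
    rw [sum_eq_sum_last _ fun l _ => hz l (by omega) (by omega) (by omega),
      ← Finset.sum_add_distrib]
    simpa [finiteBlock, show m ≠ m + 1 + 1 by omega] using h.upper_sum i

/-- The matrix-geometric vector with blocks `v₀ R^k + v_C R̂^(C-k)`. -/
def geometricVector (C : ℕ) (R Rh : Matrix (Fin n) (Fin n) ℝ) :
    ((Fin n → ℝ) × (Fin n → ℝ)) →ₗ[ℝ] (Fin (C + 1) × Fin n → ℝ) where
  toFun v x := (v.1 ᵥ* R ^ (x.1 : ℕ) + v.2 ᵥ* Rh ^ (C - (x.1 : ℕ))) x.2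
  map_add' u v := by
    ext x
    simp only [Prod.fst_add, Prod.snd_add, Matrix.add_vecMul, Pi.add_apply]
    ring
  map_smul' a v := by
    ext x
    simp [Matrix.smul_vecMul, mul_add]

theorem geometricVector_apply (C : ℕ) (R Rh : Matrix (Fin n) (Fin n) ℝ)
    (v : (Fin n → ℝ) × (Fin n → ℝ)) (x : Fin (C + 1) × Fin n) :
    geometricVector C R Rh v x =
      (v.1 ᵥ* R ^ (x.1 : ℕ) + v.2 ᵥ* Rh ^ (C - (x.1 : ℕ))) x.2 := rfl

/-- Identifies the normalisation of the boundary system with total mass one, after the reflection `i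
↦ C - i`. -/
theorem sum_geometricVector (C : ℕ) (R Rh : Matrix (Fin n) (Fin n) ℝ)
    (v : (Fin n → ℝ) × (Fin n → ℝ)) :
    ∑ x, geometricVector C R Rh v x =
      v.1 ⬝ᵥ ((∑ i ∈ Finset.range (C + 1), R ^ i) *ᵥ (fun _ => 1)) +
      v.2 ⬝ᵥ ((∑ i ∈ Finset.range (C + 1), Rh ^ i) *ᵥ (fun _ => 1)) := by
  have hr : ∑ i ∈ Finset.range (C + 1), Rh ^ i = ∑ i ∈ Finset.range (C + 1), Rh ^ (C - i) := by
    rw [← Finset.sum_range_reflect]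
    simp
  have hsum : ∀ u : Fin n → ℝ, ∑ i, u i = u ⬝ᵥ (fun _ => 1) := fun u => by simp [dotProduct]
  rw [hr, Fintype.sum_prod_type]
  simp only [geometricVector_apply, hsum, Matrix.dotProduct_mulVec]
  rw [Fin.sum_univ_eq_sum_range (fun k => (v.1 ᵥ* R ^ k + v.2 ᵥ* Rh ^ (C - k)) ⬝ᵥ fun _ => 1)
    (C + 1)]
  simp only [Matrix.vecMul_sum, sum_dotProduct, add_dotProduct, Finset.sum_add_distrib]

/-- A matrix-geometric vector built from a null vector of the boundary matrix is invariant. -/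
theorem geometricVector_vecMul_eq_zero {c : ℕ} {R Rh : Matrix (Fin n) (Fin n) ℝ}
    (hR : Ap + R * A0 + R * R * Am = 0) (hRh : Am + Rh * A0 + Rh * Rh * Ap = 0)
    {v : (Fin n → ℝ) × (Fin n → ℝ)}
    (hv : Sum.elim v.1 v.2 ᵥ* boundaryMatrix (c + 1) Am Ap B0 C0 R Rh = 0) :
    geometricVector (c + 1) R Rh v ᵥ* finiteQBD (c + 1) Am A0 Ap B0 C0 = 0 := by
  rw [boundaryMatrix, Matrix.vecMul_fromBlocks, Nat.add_sub_cancel] at hv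
  simp only [Sum.elim_comp_inl, Sum.elim_comp_inr] at hv
  -- The two halves of the boundary system are the balance equations at levels `0` and `c + 1`.
  have hv0 : v.1 ᵥ* (B0 + R * Am) + v.2 ᵥ* (Rh ^ c * (Rh * B0 + Am)) = 0 := by
    ext j; exact congrFun hv (Sum.inl j)
  have hvC : v.1 ᵥ* (R ^ c * (R * C0 + Ap)) + v.2 ᵥ* (C0 + Rh * Ap) = 0 := by
    ext j; exact congrFun hv (Sum.inr j)
  ext ⟨⟨l, hl⟩, j⟩
  set ψ : ℕ → Fin n → ℝ := fun k => v.1 ᵥ* R ^ k + v.2 ᵥ* Rh ^ (c + 1 - k) with hψ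
  have hsum : (geometricVector (c + 1) R Rh v ᵥ* finiteQBD (c + 1) Am A0 Ap B0 C0) (⟨l, hl⟩, j) =
      (∑ k ∈ Finset.range (c + 2), ψ k ᵥ* finiteBlock (c + 1) Am A0 Ap B0 C0 k l) j := by
    rw [Finset.sum_apply, ← Fin.sum_univ_eq_sum_range
      (fun k => (ψ k ᵥ* finiteBlock (c + 1) Am A0 Ap B0 C0 k l) j) (c + 2)]
    simp only [Matrix.vecMul, dotProduct, Fintype.sum_prod_type, finiteQBD_apply]
    rfl
  have hz : ∀ k, l ≠ k + 1 → k ≠ l + 1 → k ≠ l →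
      ψ k ᵥ* finiteBlock (c + 1) Am A0 Ap B0 C0 k l = 0 := by
    intro k h1 h2 h3
    simp [finiteBlock, h1, h2, h3]
  rw [hsum]
  suffices h : ∑ k ∈ Finset.range (c + 2), ψ k ᵥ* finiteBlock (c + 1) Am A0 Ap B0 C0 k l = 0 by
    rw [h]; rfl
  have hpow : ∀ r : ℕ, Rh ^ (r + 2) * Ap + Rh ^ (r + 1) * A0 + Rh ^ r * Am = 0 := by
    intro r
    have : Rh ^ (r + 2) * Ap + Rh ^ (r + 1) * A0 + Rh ^ r * Am =
        Rh ^ r * (Am + Rh * A0 + Rh * Rh * Ap) := by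
      simp only [pow_succ]; noncomm_ring
    rw [this, hRh, mul_zero]
  have hpow' : ∀ r : ℕ, R ^ r * Ap + R ^ (r + 1) * A0 + R ^ (r + 2) * Am = 0 := by
    intro r
    have : R ^ r * Ap + R ^ (r + 1) * A0 + R ^ (r + 2) * Am =
        R ^ r * (Ap + R * A0 + R * R * Am) := by
      simp only [pow_succ]; noncomm_ring
    rw [this, hR, mul_zero]
  rcases Nat.eq_zero_or_pos l with rfl | hl0
  · rw [sum_eq_sum_first _ fun k _ _ => hz k (by omega) (by omega) (by omega)]
    have h0 : finiteBlock (c + 1) Am A0 Ap B0 C0 0 0 = B0 := by simp [finiteBlock]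
    have h1 : finiteBlock (c + 1) Am A0 Ap B0 C0 1 0 = Am := by simp [finiteBlock]
    rw [h0, h1, ← hv0, hψ]
    simp only [Nat.sub_zero, Nat.add_sub_cancel, pow_zero, Matrix.add_vecMul,
      Matrix.vecMul_vecMul, Matrix.vecMul_add, mul_add, one_mul, pow_succ, mul_assoc]
    abel
  obtain ⟨m, rfl⟩ := Nat.exists_eq_add_of_lt hl0
  simp only [zero_add] at *
  rcases Nat.lt_or_ge m c with hm | hm
  · rw [sum_eq_sum_adjacent hm _ fun k _ _ _ => hz k (by omega) (by omega) (by omega)]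
    have h0 : finiteBlock (c + 1) Am A0 Ap B0 C0 m (m + 1) = Ap := by simp [finiteBlock]
    have h1 : finiteBlock (c + 1) Am A0 Ap B0 C0 (m + 1) (m + 1) = A0 := by
      simp [finiteBlock, hm.ne]
    have h2 : finiteBlock (c + 1) Am A0 Ap B0 C0 (m + 2) (m + 1) = Am := by simp [finiteBlock]
    -- With `c = m + r + 1` the truncated exponents of `Rh` at levels `m`, `m + 1`, `m + 2` become
    -- `r + 2`, `r + 1`, `r`.
    obtain ⟨r, rfl⟩ := Nat.exists_eq_add_of_lt hm
    have e0 : m + r + 1 + 1 - m = r + 2 := by omega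
    have e1 : m + r + 1 + 1 - (m + 1) = r + 1 := by omega
    have e2 : m + r + 1 + 1 - (m + 2) = r := by omega
    rw [h0, h1, h2, hψ]
    simp only [e0, e1, e2, Matrix.add_vecMul, Matrix.vecMul_vecMul]
    calc _ = v.1 ᵥ* (R ^ m * Ap + R ^ (m + 1) * A0 + R ^ (m + 2) * Am) +
          v.2 ᵥ* (Rh ^ (r + 2) * Ap + Rh ^ (r + 1) * A0 + Rh ^ r * Am) := by
          simp only [Matrix.vecMul_add]; abel
      _ = 0 := by rw [hpow, hpow', Matrix.vecMul_zero, Matrix.vecMul_zero, add_zero]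
  · obtain rfl : m = c := by omega
    rw [sum_eq_sum_last _ fun k _ => hz k (by omega) (by omega) (by omega)]
    have h0 : finiteBlock (m + 1) Am A0 Ap B0 C0 m (m + 1) = Ap := by simp [finiteBlock]
    have h1 : finiteBlock (m + 1) Am A0 Ap B0 C0 (m + 1) (m + 1) = C0 := by simp [finiteBlock]
    have e0 : m + 1 - m = 1 := by omega
    rw [h0, h1, ← hvC, hψ]
    simp only [e0, Nat.sub_self, pow_zero, Matrix.add_vecMul,
      Matrix.vecMul_vecMul, Matrix.vecMul_add, mul_add, one_mul, pow_succ, mul_assoc]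
    abel

/-- The rows of the boundary matrix sum to zero. -/
theorem boundaryMatrix_mulVec_one (h : IsQBD Am A0 Ap B0 C0) {c : ℕ}
    {R Rh : Matrix (Fin n) (Fin n) ℝ}
    (hR : Ap + R * A0 + R * R * Am = 0) (hRh : Am + Rh * A0 + Rh * Rh * Ap = 0) :
    boundaryMatrix (c + 1) Am Ap B0 C0 R Rh *ᵥ (fun _ => 1) = 0 := by
  set e : Fin n → ℝ := fun _ => 1 with he
  have hsum : ∀ (M : Matrix (Fin n) (Fin n) ℝ) i, (M *ᵥ e) i = ∑ j, M i j := fun M i => by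
    simp [mulVec_apply_eq_sum, he]
  have hB : B0 *ᵥ e = -(Ap *ᵥ e) := by
    ext i
    have := h.lower_sum i
    rw [Finset.sum_add_distrib] at this
    rw [Pi.neg_apply, hsum, hsum]; linarith
  have hC : C0 *ᵥ e = -(Am *ᵥ e) := by
    ext i
    have := h.upper_sum i
    rw [Finset.sum_add_distrib] at this
    rw [Pi.neg_apply, hsum, hsum]; linarith
  have hA : A0 *ᵥ e = -(Am *ᵥ e) - Ap *ᵥ e := by
    ext i
    have := h.mid_sum i
    rw [Finset.sum_add_distrib, Finset.sum_add_distrib] at this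
    rw [Pi.sub_apply, Pi.neg_apply, hsum, hsum, hsum]; linarith
  -- Applied to the ones vector, the quadratic equation says that `N` fixes `P 1 - N M 1`, so the
  -- powers drop out of the row sums.
  have hfix : ∀ (N P M : Matrix (Fin n) (Fin n) ℝ), P + N * A0 + N * N * M = 0 →
      A0 *ᵥ e = -(M *ᵥ e) - P *ᵥ e → ∀ k : ℕ,
      N ^ k *ᵥ (P *ᵥ e - N *ᵥ (M *ᵥ e)) = P *ᵥ e - N *ᵥ (M *ᵥ e) := by
    intro N P M hN hA k
    have h1 : N *ᵥ (P *ᵥ e - N *ᵥ (M *ᵥ e)) = P *ᵥ e - N *ᵥ (M *ᵥ e) := by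
      have h2 := congrArg (· *ᵥ e) hN
      simp only [Matrix.add_mulVec, ← Matrix.mulVec_mulVec, hA, Matrix.mulVec_sub,
        Matrix.mulVec_neg, Matrix.zero_mulVec] at h2
      rw [Matrix.mulVec_sub, ← sub_eq_zero, ← neg_eq_zero, ← h2]
      abel
    induction k with
    | zero => simp
    | succ k ih => rw [pow_succ, ← Matrix.mulVec_mulVec, h1, ih]
  have h0 : (B0 + R * Am) *ᵥ e + (R ^ c * (R * C0 + Ap)) *ᵥ e = 0 := by
    have h1 := hfix R Ap Am hR hA c
    have h2 : (R * C0 + Ap) *ᵥ e = Ap *ᵥ e - R *ᵥ (Am *ᵥ e) := by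
      rw [Matrix.add_mulVec, ← Matrix.mulVec_mulVec, hC, Matrix.mulVec_neg]; abel
    rw [← Matrix.mulVec_mulVec, h2, h1, Matrix.add_mulVec, hB, ← Matrix.mulVec_mulVec]
    abel
  have h1 : (Rh ^ c * (Rh * B0 + Am)) *ᵥ e + (C0 + Rh * Ap) *ᵥ e = 0 := by
    have h1 := hfix Rh Am Ap hRh (by rw [hA]; abel) c
    have h2 : (Rh * B0 + Am) *ᵥ e = Am *ᵥ e - Rh *ᵥ (Ap *ᵥ e) := by
      rw [Matrix.add_mulVec, ← Matrix.mulVec_mulVec, hB, Matrix.mulVec_neg]; abel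
    rw [← Matrix.mulVec_mulVec, h2, h1, Matrix.add_mulVec, hC, ← Matrix.mulVec_mulVec]
    abel
  rw [boundaryMatrix, Matrix.fromBlocks_mulVec, Nat.add_sub_cancel]
  ext (i | i)
  · exact congrFun h0 i
  · exact congrFun h1 i

/-- Multiplying the level `1` block by `Rh` and subtracting it from the level `0` block eliminates
`v_C` and leaves `v₀ (1 - R Rh) = 0`; the top level then gives `v_C = 0`. -/
theorem geometricVector_injective {c : ℕ} {R Rh : Matrix (Fin n) (Fin n) ℝ}
    (hRR : IsUnit (1 - R * Rh)) : Function.Injective (geometricVector (c + 1) R Rh) := by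
  refine (injective_iff_map_eq_zero _).2 fun v hv => ?_
  have hk : ∀ k, k < c + 2 → v.1 ᵥ* R ^ k + v.2 ᵥ* Rh ^ (c + 1 - k) = 0 := by
    intro k hk
    ext i
    exact congrFun hv (⟨k, hk⟩, i)
  have h0 := hk 0 (by omega)
  have h1 := hk 1 (by omega)
  have h2 := hk (c + 1) (by omega)
  simp only [pow_zero, Matrix.vecMul_one, Nat.sub_zero, pow_one, Nat.add_sub_cancel,
    Nat.sub_self] at h0 h1 h2
  have h3 : v.1 ᵥ* (1 - R * Rh) = 0 := by
    have h4 := congrArg (· ᵥ* Rh) h1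
    simp only [Matrix.add_vecMul, Matrix.vecMul_vecMul, ← pow_succ, Matrix.zero_vecMul] at h4
    rw [Matrix.vecMul_sub, Matrix.vecMul_one, ← sub_eq_zero.2 (h0.trans h4.symm)]
    abel
  have hv1 : v.1 = 0 :=
    Matrix.vecMul_injective_of_isUnit hRR (h3.trans (Matrix.zero_vecMul _).symm)
  rw [hv1, Matrix.zero_vecMul, zero_add] at h2
  exact Prod.ext hv1 h2

/-- Existence and uniqueness of the solution of the boundary system, which represents the
stationary distribution. -/
theorem existsUnique_solvesBoundary (hn : 0 < n) (h : IsQBD Am A0 Ap B0 C0) {c : ℕ}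
    (hfin : IrreducibleRates (finiteQBD (c + 1) Am A0 Ap B0 C0))
    {R Rh : Matrix (Fin n) (Fin n) ℝ}
    (hR : Ap + R * A0 + R * R * Am = 0) (hRh : Am + Rh * A0 + Rh * Rh * Ap = 0)
    (hRR : IsUnit (1 - R * Rh)) :
    ∃! v, SolvesBoundary (c + 1) Am Ap B0 C0 R Rh v := by
  have hoff := finiteQBD_off_nonneg (C := c + 1) h
  have hrow := finiteQBD_sum_eq_zero (c := c) h
  have hinj := geometricVector_injective (c := c) hRR
  obtain ⟨u, hu0, hu⟩ : ∃ u, u ≠ 0 ∧ u ᵥ* boundaryMatrix (c + 1) Am Ap B0 C0 R Rh = 0 := by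
    rw [Matrix.exists_vecMul_eq_zero_iff, ← Matrix.exists_mulVec_eq_zero_iff]
    exact ⟨fun _ => 1, fun h1 => one_ne_zero (congrFun h1 (Sum.inl ⟨0, hn⟩)),
      boundaryMatrix_mulVec_one h hR hRh⟩
  set v : (Fin n → ℝ) × (Fin n → ℝ) := (u ∘ Sum.inl, u ∘ Sum.inr) with hv
  have hvu : Sum.elim v.1 v.2 = u := Sum.elim_comp_inl_inr u
  have hnull := geometricVector_vecMul_eq_zero (v := v) hR hRh (by rw [hvu]; exact hu)
  set s := ∑ x, geometricVector (c + 1) R Rh v x with hs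
  -- An invariant vector of mass zero vanishes, and injectivity would then give `v = 0`; no sign
  -- information on `v` is needed.
  have hs0 : s ≠ 0 := by
    intro h0
    have h1 := eq_of_vecMul_eq_zero (v := 0) hoff hrow hfin hnull (Matrix.zero_vecMul _)
      (by simpa [hs] using h0)
    have h2 : v = 0 := hinj (h1.trans (map_zero _).symm)
    apply hu0
    rw [← hvu, h2]
    ext (i | i) <;> rfl
  refine ⟨s⁻¹ • v, ⟨?_, ?_⟩, ?_⟩
  · have : Sum.elim (s⁻¹ • v).1 (s⁻¹ • v).2 = s⁻¹ • u := by
      rw [← hvu]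
      ext (i | i) <;> rfl
    rw [this, Matrix.smul_vecMul, hu, smul_zero]
  · rw [← sum_geometricVector, map_smul]
    simp only [Pi.smul_apply, smul_eq_mul, ← Finset.mul_sum]
    exact inv_mul_cancel₀ hs0
  · rintro v' ⟨h1, h2⟩
    apply hinj
    refine eq_of_vecMul_eq_zero hoff hrow hfin (geometricVector_vecMul_eq_zero hR hRh h1) ?_ ?_
    · rw [map_smul, Matrix.smul_vecMul, hnull, smul_zero]
    · rw [sum_geometricVector, h2, map_smul]
      simp only [Pi.smul_apply, smul_eq_mul, ← Finset.mul_sum]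
      exact (inv_mul_cancel₀ hs0).symm

end FiniteQBD

/-! ### Rate matrices and the main theorem -/

/-- The rate matrix belonging to a solution of `P + L X + U X² = 0` solves the dual equation. -/
theorem rateMatrix_eq {n : ℕ} {P L U X : Matrix (Fin n) (Fin n) ℝ}
    (hX : P + L * X + U * X ^ 2 = 0) (hu : IsUnit (-(L + U * X))) :
    X = (-(L + U * X))⁻¹ * P ∧
      U + U * (-(L + U * X))⁻¹ * L + U * (-(L + U * X))⁻¹ * (U * (-(L + U * X))⁻¹) * P = 0 := by
  have hdet := (Matrix.isUnit_iff_isUnit_det _).1 hu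
  set N := -(L + U * X) with hN
  have h1 : N * X = P := by
    rw [hN, ← sub_eq_zero, ← neg_eq_zero, ← hX, pow_two]
    noncomm_ring
  have h2 : X = N⁻¹ * P := by
    rw [← h1, ← mul_assoc, Matrix.nonsing_inv_mul _ hdet, one_mul]
  refine ⟨h2, ?_⟩
  calc U + U * N⁻¹ * L + U * N⁻¹ * (U * N⁻¹) * P
      = U + U * N⁻¹ * (L + U * (N⁻¹ * P)) := by noncomm_ring
    _ = U + U * N⁻¹ * (-N) := by rw [← h2, hN, neg_neg]
    _ = U - U * (N⁻¹ * N) := by noncomm_ring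
    _ = 0 := by rw [Matrix.nonsing_inv_mul _ hdet, mul_one, sub_self]

theorem mainTheorem10 {n : ℕ} (hn : 0 < n) (C : ℕ) (hC : 1 ≤ C)
    (Am A0 Ap B0 C0 : Matrix (Fin n) (Fin n) ℝ)
    (hQBD : IsQBD Am A0 Ap B0 C0)
    (hfin : IrreducibleRates (finiteQBD C Am A0 Ap B0 C0))
    (hphase : IrreducibleRates (Am + A0 + Ap))
    (hunr : IrreducibleRates (unrestrictedQBD Am A0 Ap B0))
    (hnull : ¬ IsNullRecurrent (unrestrictedQBD Am A0 Ap B0)) :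
    ∃ G Gh : Matrix (Fin n) (Fin n) ℝ,
      IsMinNonnegSol Am A0 Ap G ∧ IsMinNonnegSol Ap A0 Am Gh ∧
      IsUnit (-(A0 + Ap * G)) ∧ IsUnit (-(A0 + Am * Gh)) ∧
      ∃ R Rh : Matrix (Fin n) (Fin n) ℝ,
        R = Ap * (-(A0 + Ap * G))⁻¹ ∧ Rh = Am * (-(A0 + Am * Gh))⁻¹ ∧
        (∃! p : Fin (C + 1) × Fin n → ℝ, IsStationaryDist (finiteQBD C Am A0 Ap B0 C0) p) ∧
        (∃! v : (Fin n → ℝ) × (Fin n → ℝ), SolvesBoundary C Am Ap B0 C0 R Rh v) ∧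
        ∀ (p : Fin (C + 1) × Fin n → ℝ) (v : (Fin n → ℝ) × (Fin n → ℝ)),
          IsStationaryDist (finiteQBD C Am A0 Ap B0 C0) p →
          SolvesBoundary C Am Ap B0 C0 R Rh v →
          ∀ k : Fin (C + 1),
            (fun i => p (k, i)) = v.1 ᵥ* R ^ (k : ℕ) + v.2 ᵥ* Rh ^ (C - (k : ℕ)) := by
  obtain ⟨c, rfl⟩ : ∃ c, C = c + 1 := ⟨C - 1, by omega⟩
  have : Nonempty (Fin n) := ⟨⟨0, hn⟩⟩
  obtain ⟨w, d, hw⟩ := exists_drift hQBD hphase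
  have hd : d ≠ 0 := by
    rintro rfl
    exact hnull (isNullRecurrent_of_drift_eq_zero hn hQBD hunr hw)
  obtain ⟨x, y, hx, hy, hneg⟩ := exists_geometric_superharmonic hQBD hd hw
  obtain ⟨G, hG, hGy⟩ := exists_isMinNonnegSol hQBD.down_nonneg hQBD.mid_nonneg hQBD.up_nonneg
    hx hy hneg
  -- Dividing by `x²` exchanges `Am` and `Ap`, so the same `y` serves the dual equation with `x⁻¹`.
  have hneg' : ∀ i, (Ap *ᵥ y) i + x⁻¹ * (A0 *ᵥ y) i + x⁻¹ ^ 2 * (Am *ᵥ y) i < 0 := by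
    intro i
    have h1 : (Ap *ᵥ y) i + x⁻¹ * (A0 *ᵥ y) i + x⁻¹ ^ 2 * (Am *ᵥ y) i =
        x⁻¹ ^ 2 * ((Am *ᵥ y) i + x * (A0 *ᵥ y) i + x ^ 2 * (Ap *ᵥ y) i) := by
      field_simp
      ring
    rw [h1]
    exact mul_neg_of_pos_of_neg (by positivity) (hneg i)
  obtain ⟨Gh, hGh, hGhy⟩ := exists_isMinNonnegSol hQBD.up_nonneg hQBD.mid_nonneg
    hQBD.down_nonneg (inv_pos.2 hx) hy hneg'
  have hApG := mul_entries_nonneg hQBD.up_nonneg hG.1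
  have hAmGh := mul_entries_nonneg hQBD.down_nonneg hGh.1
  have hnn : ∀ M : Matrix (Fin n) (Fin n) ℝ, (∀ i j, 0 ≤ M i j) → ∀ i, 0 ≤ (M *ᵥ y) i := by
    intro M hM i
    rw [mulVec_apply_eq_sum]
    exact Finset.sum_nonneg fun j _ => mul_nonneg (hM i j) (hy j).le
  -- The bounds on `G y` and `Gh y` majorise the left side by `x⁻¹ (Am + x A0 + x² Ap) y`.
  have hW : ∀ i, ((A0 + Am * Gh + Ap * G) *ᵥ y) i < 0 := by
    intro i
    have h1 := mulVec_entries_mono hQBD.up_nonneg hGy i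
    have h2 := mulVec_entries_mono hQBD.down_nonneg hGhy i
    have h3 : (Ap *ᵥ fun i => x * y i) i = x * (Ap *ᵥ y) i :=
      congrFun (Matrix.mulVec_smul Ap x y) i
    have h4 : (Am *ᵥ fun i => x⁻¹ * y i) i = x⁻¹ * (Am *ᵥ y) i :=
      congrFun (Matrix.mulVec_smul Am x⁻¹ y) i
    have h5 : (A0 *ᵥ y) i + x⁻¹ * (Am *ᵥ y) i + x * (Ap *ᵥ y) i < 0 := by
      have h6 : (A0 *ᵥ y) i + x⁻¹ * (Am *ᵥ y) i + x * (Ap *ᵥ y) i =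
          x⁻¹ * ((Am *ᵥ y) i + x * (A0 *ᵥ y) i + x ^ 2 * (Ap *ᵥ y) i) := by
        field_simp
        ring
      rw [h6]
      exact mul_neg_of_pos_of_neg (inv_pos.2 hx) (hneg i)
    simp only [Matrix.add_mulVec, Pi.add_apply, ← Matrix.mulVec_mulVec]
    linarith
  have hWu : IsUnit (A0 + Am * Gh + Ap * G) :=
    isUnit_of_mulVec_neg (fun i j hij =>
      add_nonneg (add_nonneg (hQBD.mid_nonneg i j hij) (hAmGh i j)) (hApG i j)) hy hW
  -- Dropping the nonnegative term `Am * Gh` preserves strict negativity on `y`.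
  have hU : IsUnit (-(A0 + Ap * G)) := by
    refine (isUnit_of_mulVec_neg (W := A0 + Ap * G) (fun i j hij =>
      add_nonneg (hQBD.mid_nonneg i j hij) (hApG i j)) hy fun i => ?_).neg
    have h1 := hW i
    have h2 := hnn _ hAmGh i
    simp only [Matrix.add_mulVec, Pi.add_apply] at h1 ⊢
    linarith
  have hUh : IsUnit (-(A0 + Am * Gh)) := by
    refine (isUnit_of_mulVec_neg (W := A0 + Am * Gh) (fun i j hij =>
      add_nonneg (hQBD.mid_nonneg i j hij) (hAmGh i j)) hy fun i => ?_).neg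
    have h1 := hW i
    have h2 := hnn _ hApG i
    simp only [Matrix.add_mulVec, Pi.add_apply] at h1 ⊢
    linarith
  obtain ⟨hGeq, hR⟩ := rateMatrix_eq hG.2.1 hU
  obtain ⟨-, hRh⟩ := rateMatrix_eq hGh.2.1 hUh
  -- Since `(-(A0 + Ap * G))⁻¹ * Am = G`, the product `R * Rh` is `Ap * G * (-(A0 + Am * Gh))⁻¹`,
  -- and `W` factors out.
  have hRR : IsUnit (1 - Ap * (-(A0 + Ap * G))⁻¹ * (Am * (-(A0 + Am * Gh))⁻¹)) := by
    have hdet := (Matrix.isUnit_iff_isUnit_det _).1 hUh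
    have h1 : 1 - Ap * (-(A0 + Ap * G))⁻¹ * (Am * (-(A0 + Am * Gh))⁻¹) =
        -(A0 + Am * Gh + Ap * G) * (-(A0 + Am * Gh))⁻¹ := by
      calc _ = 1 - Ap * ((-(A0 + Ap * G))⁻¹ * Am) * (-(A0 + Am * Gh))⁻¹ := by noncomm_ring
        _ = -(A0 + Am * Gh) * (-(A0 + Am * Gh))⁻¹ - Ap * G * (-(A0 + Am * Gh))⁻¹ := by
          rw [← hGeq, Matrix.mul_nonsing_inv _ hdet]
        _ = _ := by rw [← sub_mul]; congr 1; abel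
    rw [h1]
    exact hWu.neg.mul (Matrix.isUnit_nonsing_inv_iff.2 hUh)
  refine ⟨G, Gh, hG, hGh, hU, hUh, _, _, rfl, rfl,
    existsUnique_isStationaryDist (finiteQBD_off_nonneg hQBD) (finiteQBD_sum_eq_zero hQBD) hfin,
    existsUnique_solvesBoundary hn hQBD hfin hR hRh hRR, ?_⟩
  rintro p v ⟨-, hp1, hp⟩ ⟨hv, hv1⟩ k
  have hpv := eq_of_vecMul_eq_zero (finiteQBD_off_nonneg hQBD) (finiteQBD_sum_eq_zero hQBD) hfin hp
    (geometricVector_vecMul_eq_zero hR hRh hv) (by rw [hp1, sum_geometricVector, hv1])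
  ext i
  rw [hpv]
  rfl
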